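/- Definitions. An enumerated group is a group with underlying set $\mathbf N$. Recording its multiplication, inversion and identity identifies the set $\mathcal G$ of enumerated groups with a subset of $\mathbf N^{\mathbf N\times\mathbf N}\times\mathbf N^{\mathbf N}\times\mathbf N$ ($\mathbf N$ discrete, product topology), and $\mathcal G$ gets the subspace topology. For a property $P$ of countable groups, $\mathcal G_P\subseteq\mathcal G$ is the subspace of enumerated groups with $P$. An isomorphism class in $\mathcal G_P$ is a set $\{G\in\mathcal G_P : G\cong H\}$, $H$ a group; a subset is comeager if it contains a countable intersection of dense open sets. A finitely generated group has solvable word problem if the set of words in a finite generating tuple that represent the identity is computable. The property $P$ is - strongly undecidable if there are a finitely presented group $G$ and a finite $X\subseteq G$ such that some surjective homomorphism from $G$ onto a group with $P$ is injective on $X$, and every group $H$ with $P$ for which there is a surjective homomorphism $G\to H$ injective on $X$ has unsolvable word problem; - recursively axiomatizable if there is a recursive set $T$ of first-order sentences in the language of groups such that the countable groups with $P$ are exactly the countable models of $T$; - Boone–Higman if every finitely generated group with $P$ and with solvable word problem embeds in a simple subgroup of a finitely presented group with $P$; - closed under subgroups if every subgroup of a countable group with $P$ has $P$. Theorem 1.7.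 Let $P$ be a property of countable groups that is strongly undecidable, recursively axiomatizable, Boone–Higman, and closed under subgroups. Then $\mathcal G_P$ is a Polish space, and no isomorphism class is comeager in $\mathcal G_P$. -/

import Mathlib

namespace EnumGrp

/-! ## The space of enumerated groups -/

/-- An enumerated group: a group structure on the set `ℕ`, given by its multiplication function,
its inversion function and its identity element. -/
def EnumeratedGroup : Type :=
  {x : (ℕ × ℕ → ℕ) × (ℕ → ℕ) × ℕ //
    (∀ m n p, x.1 (x.1 (m, n), p) = x.1 (m, x.1 (n, p))) ∧
    (∀ m, x.1 (x.2.2, m) = m) ∧ (∀ m, x.1 (m, x.2.2) = m) ∧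
    (∀ m, x.1 (x.2.1 m, m) = x.2.2) ∧ (∀ m, x.1 (m, x.2.1 m) = x.2.2)}

/-- The subspace topology from `ℕ^(ℕ × ℕ) × ℕ^ℕ × ℕ`, where `ℕ` is discrete and the powers carry
the product topology. -/
instance : TopologicalSpace EnumeratedGroup :=
  instTopologicalSpaceSubtype

/-- The underlying set `ℕ` of an enumerated group, as a type of its own, so that its group
structure is not confused with the arithmetic of `ℕ`. -/
def EnumeratedGroup.Carrier (_ : EnumeratedGroup) : Type := ℕ

instance (G : EnumeratedGroup) : Group G.Carrier where
  mul a b := G.val.1 (a, b)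
  inv a := G.val.2.1 a
  one := G.val.2.2
  mul_assoc := G.property.1
  one_mul := G.property.2.1
  mul_one := G.property.2.2.1
  inv_mul_cancel := G.property.2.2.2.1

/-! ## Properties of countable groups -/

/-- A property of groups. Only its values at countable groups (each of which is isomorphic to one
in `Type`) matter below. -/
abbrev GroupProperty := (G : Type) → [Group G] → Prop

/-- The space of enumerated groups with the property `P`, with the subspace topology. -/
abbrev EnumeratedGroupsWith (P : GroupProperty) : Type := {G : EnumeratedGroup // P G.Carrier}

/-- The class, inside the space of enumerated groups with `P`, of those isomorphic to `H`. -/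
def isomorphismClass (P : GroupProperty) (H : Type) [Group H] : Set (EnumeratedGroupsWith P) :=
  {G | Nonempty (G.val.Carrier ≃* H)}

/-- Every subgroup of a countable group with `P` has `P`. -/
def ClosedUnderSubgroups (P : GroupProperty) : Prop :=
  ∀ (G : Type) [Group G] [Countable G], P G → ∀ K : Subgroup G, P K

/-- The value of a group word, i.e. a list of letters `xᵢ` (written `(i, true)`) and `xᵢ⁻¹`
(written `(i, false)`), under an assignment of the variables. -/
def wordValue {ι G : Type} [Group G] (v : ι → G) (w : List (ι × Bool)) : G :=
  FreeGroup.lift v (FreeGroup.mk w)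

/-- `G` is finitely generated with solvable word problem: for some finite tuple `s` of generators
the set of words in the generators and their inverses that represent the identity is computable.
(Whether this holds does not depend on the choice of the finite generating tuple.) -/
def HasSolvableWordProblem (G : Type) [Group G] : Prop :=
  ∃ (n : ℕ) (s : Fin n → G), Subgroup.closure (Set.range s) = ⊤ ∧
    ComputablePred fun w : List (Fin n × Bool) => wordValue s w = 1

/-- Every finitely generated group with solvable word problem and property `P` embeds in a simple
subgroup of a finitely presented group with property `P`. -/
def BooneHigman (P : GroupProperty) : Prop :=
  ∀ (G : Type) [Group G], HasSolvableWordProblem G → P G →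
    ∃ (H : Type) (_ : Group H), Group.IsFinitelyPresented H ∧ P H ∧
      ∃ K : Subgroup H, IsSimpleGroup K ∧ ∃ f : G →* K, Function.Injective f

/-- There are a finitely presented group `G` and a finite subset `X` of `G` such that `G` has a
quotient with `P` whose quotient map is injective on `X`, and every such quotient has unsolvable
word problem. -/
def StronglyUndecidable (P : GroupProperty) : Prop :=
  ∃ (G : Type) (_ : Group G) (X : Set G), Group.IsFinitelyPresented G ∧ X.Finite ∧
    (∃ (H : Type) (_ : Group H), P H ∧
      ∃ φ : G →* H, Function.Surjective φ ∧ Set.InjOn φ X) ∧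
    (∀ (H : Type) [Group H], P H →
      (∃ φ : G →* H, Function.Surjective φ ∧ Set.InjOn φ X) → ¬ HasSolvableWordProblem H)

/-! ## First-order sentences in the language of groups, in prenex normal form -/

/-- `(w, true)` stands for the equation `w = e`, and `(w, false)` for the inequation `w ≠ e`,
where `w` is a word in the variables `x₀, x₁, …`. -/
abbrev GroupLiteral := List (ℕ × Bool) × Bool

/-- A finite system (conjunction) of equations and inequations. -/
abbrev GroupSystem := List GroupLiteral

/-- A quantifier-free formula in disjunctive normal form: a finite disjunction of systems. -/
abbrev QFFormula := List GroupSystem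

/-- A formula `Q₀x₀ ⋯ Qₘ₋₁xₘ₋₁ ψ` with `ψ` quantifier-free: the list of the quantifiers
(`true` for `∀`, `false` for `∃`) and the matrix `ψ`. -/
abbrev PrenexFormula := List Bool × QFFormula

/-- All variables of the matrix are bound by the quantifiers of the prefix. -/
def PrenexFormula.IsSentence (σ : PrenexFormula) : Prop :=
  ∀ S ∈ σ.2, ∀ l ∈ S, ∀ p ∈ l.1, p.1 < σ.1.length

def GroupLiteral.Holds {G : Type} [Group G] (v : ℕ → G) (l : GroupLiteral) : Prop :=
  if l.2 = true then wordValue v l.1 = 1 else wordValue v l.1 ≠ 1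

def QFFormula.Holds {G : Type} [Group G] (v : ℕ → G) (ψ : QFFormula) : Prop :=
  ∃ S ∈ ψ, ∀ l ∈ S, GroupLiteral.Holds v l

/-- Truth in `G` of a quantifier prefix, binding `xᵢ, xᵢ₊₁, …` in this order, applied to `ψ`, under
the assignment `v` of the variables. -/
def prenexHolds {G : Type} [Group G] (ψ : QFFormula) : List Bool → ℕ → (ℕ → G) → Prop
  | [], _, v => QFFormula.Holds v ψ
  | true :: qs, i, v => ∀ g : G, prenexHolds ψ qs (i + 1) (Function.update v i g)
  | false :: qs, i, v => ∃ g : G, prenexHolds ψ qs (i + 1) (Function.update v i g)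

/-- Truth of a sentence in the group `G`. (The initial assignment is irrelevant for sentences.) -/
def Satisfies (G : Type) [Group G] (σ : PrenexFormula) : Prop :=
  prenexHolds (G := G) σ.2 σ.1 0 (fun _ => 1)

/-- There is a recursive set `T` of first-order sentences such that the countable groups with `P`
are exactly the countable groups that are models of `T`. -/
def RecursivelyAxiomatizable (P : GroupProperty) : Prop :=
  ∃ T : Set PrenexFormula, (∀ σ ∈ T, σ.IsSentence) ∧ (ComputablePred fun σ => σ ∈ T) ∧
    ∀ (G : Type) [Group G] [Countable G], P G ↔ ∀ σ ∈ T, Satisfies G σ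

end EnumGrp

/-! The engine is a form of Herbrand's theorem: if a finite system of equations and inequations has
no solution in the countable models of a recursive theory T, this has a finite certificate. Add a
Skolem variable for each existential quantifier and each choice of words for the earlier variables.
Then T becomes a list of quantifier-free instances, and a tuple generating a group and satisfying
all of them makes that group a model of T. Compactness comes from a limit of marked groups
(`exists_limit_group`), and a finite system is unsolvable in all groups exactly when one of its
inequations fails in the group presented by its equations. So unsatisfiability is recursively
enumerable (`not_satisfiableIn_iff`, `rePred_not_satisfiableIn`).

Polishness: the groups with P form a closed subset of a Polish space. If N is a limit of groups with
P, every finite part of its diagram is realized in a group with P. By compactness N embeds in a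
countable model of T, and closure under subgroups gives N the property.

Comeager classes: strong undecidability yields a finite system S, solvable in some group with P,
whose solutions in countable groups with P all have undecidable relations. Solving S at given
indices is an open condition, so a comeager class contains a group with a solution c. Every group in
the class carries a copy of c at one of countably many index tuples d. By Baire, for some d the
groups in which d has exactly the relations of c contain a nonempty open set, so finitely many
relations and non-relations decide all relations of d. A word is then trivial at d iff adding its
negation to these data and S is unsatisfiable, and nontrivial iff adding its equation is. Both
conditions are recursively enumerable, so the relations are decidable, a contradiction. -/

namespace EnumGrp

/-! ### Values of words -/

section Words

variable {ι κ G H : Type} [Group G] [Group H]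

@[simp] lemma wordValue_nil (v : ι → G) : wordValue v [] = 1 := by
  simp [wordValue]

lemma wordValue_append (v : ι → G) (a b : List (ι × Bool)) :
    wordValue v (a ++ b) = wordValue v a * wordValue v b := by
  rw [wordValue, ← FreeGroup.mul_mk, map_mul]; rfl

lemma wordValue_cons (v : ι → G) (p : ι × Bool) (w : List (ι × Bool)) :
    wordValue v (p :: w) = (if p.2 then v p.1 else (v p.1)⁻¹) * wordValue v w := by
  rcases p with ⟨i, _ | _⟩ <;> simp [wordValue]

@[simp] lemma wordValue_letter (v : ι → G) (i : ι) : wordValue v [(i, true)] = v i := by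
  simp [wordValue_cons]

lemma wordValue_invRev (v : ι → G) (w : List (ι × Bool)) :
    wordValue v (FreeGroup.invRev w) = (wordValue v w)⁻¹ := by
  rw [wordValue, ← FreeGroup.inv_mk, map_inv]; rfl

lemma map_wordValue (f : G →* H) (v : ι → G) (w : List (ι × Bool)) :
    f (wordValue v w) = wordValue (f ∘ v) w := by
  induction w with
  | nil => simp
  | cons p w ih => rcases p with ⟨i, _ | _⟩ <;> simp [wordValue_cons, ih]

lemma wordValue_congr {v v' : ι → G} {w : List (ι × Bool)} (h : ∀ p ∈ w, v p.1 = v' p.1) :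
    wordValue v w = wordValue v' w := by
  induction w with
  | nil => simp
  | cons p w ih =>
    rw [wordValue_cons, wordValue_cons, h p (by simp), ih fun q hq => h q (by simp [hq])]

lemma exists_wordValue_of_mem_closure (v : ι → G) {g : G}
    (hg : g ∈ Subgroup.closure (Set.range v)) : ∃ w, wordValue v w = g := by
  rw [← FreeGroup.range_lift_eq_closure] at hg
  obtain ⟨x, rfl⟩ := hg
  classical exact ⟨x.toWord, by rw [wordValue, FreeGroup.mk_toWord]⟩

/-- Substitution of words for the variables of a word. -/
def substWord (θ : ι → List (κ × Bool)) (w : List (ι × Bool)) : List (κ × Bool) :=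
  w.flatMap fun p => if p.2 = true then θ p.1 else FreeGroup.invRev (θ p.1)

lemma wordValue_substWord (v : κ → G) (θ : ι → List (κ × Bool)) (w : List (ι × Bool)) :
    wordValue v (substWord θ w) = wordValue (fun i => wordValue v (θ i)) w := by
  induction w with
  | nil => simp [substWord]
  | cons p w ih =>
    rw [wordValue_cons, ← ih, substWord, List.flatMap_cons, wordValue_append, ← substWord]
    split_ifs <;> simp [wordValue_invRev]

/-- Renaming of the variables of a word. -/
def renameWord (f : ι → κ) (w : List (ι × Bool)) : List (κ × Bool) :=
  w.map fun p => (f p.1, p.2)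

lemma wordValue_renameWord (v : κ → G) (f : ι → κ) (w : List (ι × Bool)) :
    wordValue v (renameWord f w) = wordValue (v ∘ f) w := by
  induction w with
  | nil => simp [renameWord]
  | cons p w ih => rw [wordValue_cons, ← ih, renameWord, List.map_cons, wordValue_cons]; rfl

end Words

/-! ### Invariance of truth under isomorphism -/

section Truth

variable {G H : Type} [Group G] [Group H]

lemma GroupLiteral.holds_iff (v : ℕ → G) (l : GroupLiteral) :
    GroupLiteral.Holds v l ↔ (wordValue v l.1 = 1 ↔ l.2 = true) := by
  unfold GroupLiteral.Holds
  split_ifs with h <;> simp [h]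

lemma QFFormula.holds_map {f : G →* H} (hf : Function.Injective f) (v : ℕ → G) (ψ : QFFormula) :
    QFFormula.Holds (f ∘ v) ψ ↔ QFFormula.Holds v ψ := by
  simp only [QFFormula.Holds, GroupLiteral.holds_iff, ← map_wordValue, map_eq_one_iff f hf]

lemma prenexHolds_mulEquiv (e : G ≃* H) (ψ : QFFormula) (qs : List Bool) (i : ℕ) (v : ℕ → G) :
    prenexHolds ψ qs i (e ∘ v) ↔ prenexHolds ψ qs i v := by
  have hup : ∀ (v : ℕ → G) (i : ℕ) (g : G),
      Function.update (e ∘ v) i (e g) = e ∘ Function.update v i g := fun v i g => by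
    rw [Function.comp_update]
  induction qs generalizing i v with
  | nil => exact QFFormula.holds_map (f := e.toMonoidHom) e.injective v ψ
  | cons q qs ih =>
    cases q
    · exact e.surjective.exists.trans (by simp only [hup, ih]; rfl)
    · exact e.surjective.forall.trans (by simp only [hup, ih]; rfl)

lemma satisfies_mulEquiv (e : G ≃* H) (σ : PrenexFormula) : Satisfies G σ ↔ Satisfies H σ := by
  unfold Satisfies
  rw [← prenexHolds_mulEquiv e]
  simp [Function.comp_def]

end Truth

/-! ### Skolem variables and Herbrand instances -/

section Herbrand

variable {G : Type} [Group G]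

/-- The assignment given by a list of words: variables beyond its end take the value `1`. -/
def listValues (v : ℕ → G) (θ : List (List (ℕ × Bool))) (i : ℕ) : G :=
  wordValue v (θ.getD i [])

lemma listValues_nil (v : ℕ → G) : listValues v [] = fun _ => 1 := by
  ext i; simp [listValues]

lemma listValues_concat (v : ℕ → G) (θ : List (List (ℕ × Bool))) (w : List (ℕ × Bool)) :
    listValues v (θ ++ [w]) = Function.update (listValues v θ) θ.length (wordValue v w) := by
  ext i
  rcases lt_trichotomy i θ.length with h | rfl | h
  · rw [Function.update_of_ne h.ne, listValues, listValues, List.getD_append _ _ _ _ h]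
  · simp [listValues]
  · rw [Function.update_of_ne h.ne', listValues, listValues, List.getD_eq_default _ _ h.le,
      List.getD_eq_default _ _ (by simp; omega)]

/-- The variable naming a witness for the quantifier of `σ` at position `θ.length`, where the
previous variables are interpreted by the words in `θ`. -/
def skolemVar (σ : PrenexFormula) (θ : List (List (ℕ × Bool))) : ℕ :=
  2 * Encodable.encode (σ, θ) + 1

lemma encode_lt_encode_of_mem {α : Type*} [Encodable α] {a : α} {l : List α} (h : a ∈ l) :
    Encodable.encode a < Encodable.encode l := by
  induction l with
  | nil => simp at h
  | cons b l ih =>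
    rw [Encodable.encode_list_cons]
    rcases List.mem_cons.1 h with rfl | h
    · exact Nat.lt_succ_of_le (Nat.left_le_pair _ _)
    · exact Nat.lt_succ_of_lt ((ih h).trans_le (Nat.right_le_pair _ _))

/-- The code of `(σ, θ)` bounds every variable in `θ`, so the guard `m < n` in `skolemAssignment`
never discards a value that the words of `θ` use. -/
lemma lt_skolemVar (σ : PrenexFormula) (θ : List (List (ℕ × Bool))) (i : ℕ)
    {p : ℕ × Bool} (hp : p ∈ θ.getD i []) : p.1 < skolemVar σ θ := by
  have hw : θ.getD i [] ∈ θ := by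
    by_cases hi : i < θ.length
    · rw [List.getD_eq_getElem _ _ hi]; exact List.getElem_mem _
    · rw [List.getD_eq_default _ _ (not_lt.1 hi)] at hp; simp at hp
  have h₁ := encode_lt_encode_of_mem hp
  have h₂ := encode_lt_encode_of_mem hw
  have h₃ : p.1 ≤ Encodable.encode p := Nat.left_le_pair _ _
  have h₄ : Encodable.encode θ ≤ Encodable.encode (σ, θ) := Nat.right_le_pair _ _
  unfold skolemVar
  omega

/-- The words in `θ` at the positions of existential quantifiers of `σ` are the Skolem
variables. -/
def IsSkolemized (σ : PrenexFormula) (θ : List (List (ℕ × Bool))) : Prop :=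
  ∀ i < θ.length, σ.1[i]? = some false → θ[i]? = some [(skolemVar σ (θ.take i), true)]

lemma IsSkolemized.concat {σ : PrenexFormula} {θ : List (List (ℕ × Bool))}
    (h : IsSkolemized σ θ) {w : List (ℕ × Bool)}
    (hw : σ.1[θ.length]? = some false → w = [(skolemVar σ θ, true)]) :
    IsSkolemized σ (θ ++ [w]) := by
  intro i hi hσ
  rw [List.length_append, List.length_singleton] at hi
  rcases Nat.lt_succ_iff_lt_or_eq.1 hi with hi | rfl
  · rw [List.getElem?_append_left hi, List.take_append_of_le_length hi.le]
    exact h i hi hσ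
  · simp [hw hσ]

/-- Substitution of words for the variables of a quantifier-free formula. -/
def QFFormula.subst (θ : List (List (ℕ × Bool))) (ψ : QFFormula) : QFFormula :=
  ψ.map fun S => S.map fun l => (substWord (fun i => θ.getD i []) l.1, l.2)

lemma QFFormula.holds_subst (v : ℕ → G) (θ : List (List (ℕ × Bool))) (ψ : QFFormula) :
    QFFormula.Holds v (ψ.subst θ) ↔ QFFormula.Holds (listValues v θ) ψ := by
  unfold QFFormula.Holds QFFormula.subst
  simp only [List.mem_map, exists_exists_and_eq_and, forall_exists_index, and_imp,
    forall_apply_eq_imp_iff₂, GroupLiteral.holds_iff, wordValue_substWord]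
  rfl

/-- Words exhaust the group, so a universal quantifier need only be tested on values of words; an
existential one is witnessed by its Skolem variable. -/
lemma prenexHolds_of_forall_instances {v : ℕ → G} (hv : ∀ g, ∃ w, wordValue v w = g)
    {σ : PrenexFormula}
    (h : ∀ θ, θ.length = σ.1.length → IsSkolemized σ θ → QFFormula.Holds (listValues v θ) σ.2)
    (qs : List Bool) (θ : List (List (ℕ × Bool))) (hqs : σ.1.drop θ.length = qs)
    (hlen : θ.length ≤ σ.1.length) (hθ : IsSkolemized σ θ) :
    prenexHolds σ.2 qs θ.length (listValues v θ) := by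
  induction qs generalizing θ with
  | nil => exact h θ (le_antisymm hlen (List.drop_eq_nil_iff.1 hqs)) hθ
  | cons q qs ih =>
    have hq : σ.1[θ.length]? = some q := by
      rw [← List.head?_drop, hqs]; rfl
    have hlt : θ.length < σ.1.length := (List.getElem?_eq_some_iff.1 hq).1
    have hd : ∀ w, σ.1.drop (θ ++ [w]).length = qs := fun w => by
      rw [List.length_append, List.length_singleton, ← List.drop_drop, hqs]; rfl
    have key : ∀ w, (σ.1[θ.length]? = some false → w = [(skolemVar σ θ, true)]) →
        prenexHolds σ.2 qs (θ.length + 1)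
          (Function.update (listValues v θ) θ.length (wordValue v w)) := fun w hw => by
      have := ih (θ ++ [w]) (hd w) (by simpa using hlt) (hθ.concat hw)
      rwa [listValues_concat, List.length_append, List.length_singleton] at this
    cases q
    · exact ⟨_, key _ fun _ => rfl⟩
    · intro g
      obtain ⟨w, rfl⟩ := hv g
      exact key w fun hf => by simp [hq] at hf

/-- `v` interprets every Skolem variable by a witness, if there is one. -/
def InterpretsSkolemVars (v : ℕ → G) : Prop :=
  ∀ (σ : PrenexFormula) (θ : List (List (ℕ × Bool))),
    (∃ g, prenexHolds σ.2 (σ.1.drop (θ.length + 1)) (θ.length + 1)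
      (Function.update (listValues v θ) θ.length g)) →
    prenexHolds σ.2 (σ.1.drop (θ.length + 1)) (θ.length + 1)
      (Function.update (listValues v θ) θ.length (v (skolemVar σ θ)))

/-- An assignment that agrees with `u` on the even variables and whose values at the Skolem
variables are chosen by `F`. -/
noncomputable def skolemAssignment (u : ℕ → G)
    (F : PrenexFormula × List (List (ℕ × Bool)) → (ℕ → G) → G) (n : ℕ) : G :=
  if n % 2 = 0 then u (n / 2)
  else match (Encodable.decode (n / 2) : Option (PrenexFormula × List (List (ℕ × Bool)))) with
    | some s => F s (listValues (fun m => if _h : m < n then skolemAssignment u F m else 1) s.2)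
    | none => 1
termination_by n

/-- Witnesses are chosen by recursion on the variable: the even variables are prescribed, and an odd
one depends only on smaller ones. -/
lemma exists_interpretsSkolemVars (u : ℕ → G) :
    ∃ v : ℕ → G, (∀ i, v (2 * i) = u i) ∧ InterpretsSkolemVars v := by
  classical
  let F : PrenexFormula × List (List (ℕ × Bool)) → (ℕ → G) → G := fun s a =>
    Classical.epsilon fun g => prenexHolds s.1.2 (s.1.1.drop (s.2.length + 1)) (s.2.length + 1)
      (Function.update a s.2.length g)
  refine ⟨skolemAssignment u F, fun i => ?_, fun σ θ h => ?_⟩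
  · rw [skolemAssignment]; simp
  · have hv : skolemAssignment u F (skolemVar σ θ) =
        F (σ, θ) (listValues (skolemAssignment u F) θ) := by
      rw [skolemAssignment, if_neg (by unfold skolemVar; omega)]
      have : skolemVar σ θ / 2 = Encodable.encode (σ, θ) := by unfold skolemVar; omega
      rw [this, Encodable.encodek]
      refine congrArg (F (σ, θ)) ?_
      funext i
      refine wordValue_congr fun p hp => ?_
      simp [lt_skolemVar σ θ i hp]
    rw [hv]
    exact Classical.epsilon_spec h

lemma InterpretsSkolemVars.holds_instance {v : ℕ → G} (hv : InterpretsSkolemVars v)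
    {σ : PrenexFormula} (hσ : Satisfies G σ) {θ : List (List (ℕ × Bool))}
    (hlen : θ.length = σ.1.length) (hθ : IsSkolemized σ θ) :
    QFFormula.Holds (listValues v θ) σ.2 := by
  -- Truth descends along the prefix: a universal quantifier is instantiated at `θ[i]`, and at an
  -- existential one `θ[i]` is the Skolem variable, whose value is a witness.
  have key : ∀ i ≤ θ.length,
      prenexHolds σ.2 (σ.1.drop i) i (listValues v (θ.take i)) := by
    intro i
    induction i with
    | zero => intro _; simpa [listValues_nil, Satisfies] using hσ
    | succ i ih =>
      intro hi
      have hi' : i < θ.length := hi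
      have h := ih hi'.le
      have hl : (θ.take i).length = i := by simp [hi'.le]
      have hup : listValues v (θ.take (i + 1)) =
          Function.update (listValues v (θ.take i)) i (wordValue v θ[i]) := by
        rw [← List.take_concat_get' _ _ hi', listValues_concat, hl]
      have hs : i < σ.1.length := hlen ▸ hi'
      rw [List.drop_eq_getElem_cons hs] at h
      rw [hup]
      cases hq : σ.1[i] with
      | true =>
        rw [hq] at h
        exact h _
      | false =>
        rw [hq] at h
        have hw : θ[i] = [(skolemVar σ (θ.take i), true)] := by
          have := hθ i hi' (by rw [List.getElem?_eq_getElem hs, hq])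
          rwa [List.getElem?_eq_getElem hi', Option.some_inj] at this
        have := hv σ (θ.take i)
        rw [hl] at this
        rw [hw, wordValue_letter]
        exact this h
  have := key θ.length le_rfl
  rwa [List.take_length, List.drop_eq_nil_of_le hlen.ge] at this

open Classical in
/-- An enumeration of the Herbrand instances of the sentences in `T`, padded with the true formula
`[[]]`. -/
noncomputable def herbrandInstance (T : Set PrenexFormula) (k : ℕ) : QFFormula :=
  match (Encodable.decode k : Option (PrenexFormula × List (List (ℕ × Bool)))) with
  | some s =>
    if s.1 ∈ T then
      if s.2.length = s.1.1.length ∧ IsSkolemized s.1 s.2 then s.1.2.subst s.2 else [[]]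
    else [[]]
  | none => [[]]

lemma QFFormula.holds_true (v : ℕ → G) : QFFormula.Holds v [[]] := by
  simp [QFFormula.Holds]

lemma QFFormula.holds_literal (v : ℕ → G) (l : GroupLiteral) :
    QFFormula.Holds v [[l]] ↔ GroupLiteral.Holds v l := by
  rw [QFFormula.Holds, List.exists_mem_cons_iff, List.forall_mem_singleton]
  simp

lemma satisfies_of_holds_herbrandInstance {T : Set PrenexFormula} {v : ℕ → G}
    (hv : ∀ g, ∃ w, wordValue v w = g) (h : ∀ k, QFFormula.Holds v (herbrandInstance T k))
    {σ : PrenexFormula} (hσ : σ ∈ T) : Satisfies G σ := by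
  have := prenexHolds_of_forall_instances hv (σ := σ) (fun θ hlen hθ => ?_) σ.1 [] rfl
    (Nat.zero_le _) (fun i hi => absurd hi (Nat.not_lt_zero i))
  · rwa [listValues_nil] at this
  · have h := h (Encodable.encode (σ, θ))
    unfold herbrandInstance at h
    rw [Encodable.encodek] at h
    simp only [if_pos hσ] at h
    rwa [if_pos ⟨hlen, hθ⟩, QFFormula.holds_subst] at h

lemma exists_holds_herbrandInstance {T : Set PrenexFormula} (hT : ∀ σ ∈ T, Satisfies G σ)
    (u : ℕ → G) :
    ∃ v : ℕ → G, (∀ i, v (2 * i) = u i) ∧ ∀ k, QFFormula.Holds v (herbrandInstance T k) := by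
  obtain ⟨v, hu, hv⟩ := exists_interpretsSkolemVars u
  refine ⟨v, hu, fun k => ?_⟩
  unfold herbrandInstance
  split
  · split_ifs with h₁ h₂
    · rw [QFFormula.holds_subst]
      exact hv.holds_instance (hT _ h₁) h₂.1 h₂.2
    · exact QFFormula.holds_true v
    · exact QFFormula.holds_true v
  · exact QFFormula.holds_true v

end Herbrand

/-! ### Compactness via limits of marked groups -/

section Compactness

open Filter

/-- The limit is the subgroup of an ultraproduct generated by the tuple `v`, written as a quotient
of the free group by the words trivial for almost all `n`. This keeps it countable. Łoś's theorem is
needed only for quantifier-free formulas, since Herbrand instances have no quantifiers. -/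
lemma exists_limit_group (G : ℕ → Type) [∀ n, Group (G n)] (v : ∀ n, ℕ → G n) :
    ∃ (L : Type) (_ : Group L) (_ : Countable L) (x : ℕ → L), (∀ g, ∃ w, wordValue x w = g) ∧
      ∀ ψ : QFFormula, (∀ᶠ n in atTop, QFFormula.Holds (v n) ψ) → QFFormula.Holds x ψ := by
  let U : Ultrafilter ℕ := hyperfilter ℕ
  let N : Subgroup (FreeGroup ℕ) :=
    { carrier := {w | ∀ᶠ n in U, FreeGroup.lift (v n) w = 1}
      one_mem' := by simp
      mul_mem' := fun {a b} ha hb => by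
        filter_upwards [ha, hb] with n h₁ h₂ using by rw [map_mul, h₁, h₂, one_mul]
      inv_mem' := fun {a} ha => by
        filter_upwards [ha] with n h₁ using by rw [map_inv, h₁, inv_one] }
  have : N.Normal := ⟨fun a ha g => by
    filter_upwards [ha] with n h₁ using by simp [h₁]⟩
  let x : ℕ → FreeGroup ℕ ⧸ N := fun i => QuotientGroup.mk' N (FreeGroup.of i)
  have hx : ∀ w, wordValue x w = QuotientGroup.mk' N (FreeGroup.mk w) := fun w => by
    have : FreeGroup.lift x = QuotientGroup.mk' N := by ext i; simp [x]
    rw [wordValue, this]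
  have hlit : ∀ l, GroupLiteral.Holds x l ↔ ∀ᶠ n in U, GroupLiteral.Holds (v n) l := fun l => by
    have h1 : wordValue x l.1 = 1 ↔ ∀ᶠ n in U, wordValue (v n) l.1 = 1 := by
      rw [hx, QuotientGroup.mk'_apply, QuotientGroup.eq_one_iff]; rfl
    rcases l with ⟨w, _ | _⟩
    · simp only [GroupLiteral.Holds, Bool.false_eq_true, if_false, Ne, h1,
        Ultrafilter.eventually_not]
    · simpa only [GroupLiteral.Holds, if_true] using h1
  have hsys : ∀ S : GroupSystem, (∀ l ∈ S, GroupLiteral.Holds x l) ↔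
      ∀ᶠ n in U, ∀ l ∈ S, GroupLiteral.Holds (v n) l := fun S => by
    induction S with
    | nil => simp
    | cons l S ih =>
      rw [List.forall_mem_cons, ih, hlit, ← eventually_and]
      simp only [List.forall_mem_cons]
  have hgen : ∀ g, ∃ w, wordValue x w = g := fun g => by
    obtain ⟨a, rfl⟩ := QuotientGroup.mk'_surjective N g
    exact ⟨a.toWord, by rw [hx, FreeGroup.mk_toWord]⟩
  refine ⟨FreeGroup ℕ ⧸ N, inferInstance, Function.Surjective.countable (f := wordValue x) hgen, x, hgen,
    fun ψ hψ => ?_⟩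
  · have hψ' : ∀ᶠ n in U, QFFormula.Holds (v n) ψ :=
      hψ.filter_mono (Nat.cofinite_eq_atTop ▸ hyperfilter_le_cofinite)
    clear hψ
    induction ψ with
    | nil =>
      obtain ⟨n, hn⟩ := hψ'.exists
      simp [QFFormula.Holds] at hn
    | cons S ψ ih =>
      simp only [QFFormula.Holds, List.exists_mem_cons_iff, Ultrafilter.eventually_or] at hψ'
      rcases hψ' with h | h
      · exact ⟨S, by simp, (hsys S).2 h⟩
      · obtain ⟨S', hS', h'⟩ := ih h
        exact ⟨S', by simp [hS'], h'⟩

/-- Compactness: literals that are finitely satisfiable together with the Herbrand instances of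
`T` are satisfied in a countable model of `T`. -/
theorem exists_countable_model (T : Set PrenexFormula) {ι : Type*} [Encodable ι]
    (D : ι → GroupLiteral)
    (h : ∀ n : ℕ, ∃ (G : Type) (_ : Group G) (v : ℕ → G),
      (∀ k < n, QFFormula.Holds v (herbrandInstance T k)) ∧
      ∀ i, Encodable.encode i < n → GroupLiteral.Holds v (D i)) :
    ∃ (G : Type) (_ : Group G) (_ : Countable G) (v : ℕ → G),
      (∀ σ ∈ T, Satisfies G σ) ∧ ∀ i, GroupLiteral.Holds v (D i) := by
  choose G hG v hv using h
  obtain ⟨L, hL₁, hL₂, x, hx, hL⟩ := exists_limit_group G v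
  refine ⟨L, hL₁, hL₂, x, fun σ hσ => ?_, fun i => ?_⟩
  · refine satisfies_of_holds_herbrandInstance hx (fun k => hL _ ?_) hσ
    filter_upwards [eventually_gt_atTop k] with n hn using (hv n).1 k hn
  · refine (QFFormula.holds_literal _ _).1 (hL _ ?_)
    filter_upwards [eventually_gt_atTop (Encodable.encode i)] with n hn
    exact (QFFormula.holds_literal _ _).2 ((hv n).2 i hn)

end Compactness

/-! ### Refuting finite systems over all groups -/

section Refutation

/-- The product of conjugates described by a list of triples (conjugator, word, sign). -/
def conjugateProduct (c : List (List (ℕ × Bool) × List (ℕ × Bool) × Bool)) : List (ℕ × Bool) :=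
  c.flatMap fun t => t.1 ++ ((if t.2.2 = true then t.2.1 else FreeGroup.invRev t.2.1) ++
    FreeGroup.invRev t.1)

/-- A certificate that a system has no solution in any group: an inequation of the system whose
word is freely equal to a product of conjugates of words of equations of the system. -/
abbrev Refutation := List (ℕ × Bool) × List (List (ℕ × Bool) × List (ℕ × Bool) × Bool)

def Refutation.Refutes (c : Refutation) (S : GroupSystem) : Prop :=
  (c.1, false) ∈ S ∧ FreeGroup.reduce c.1 = FreeGroup.reduce (conjugateProduct c.2) ∧
    ∀ t ∈ c.2, (t.2.1, true) ∈ S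

lemma wordValue_conjugateProduct {G : Type} [Group G] (v : ℕ → G)
    (c : List (List (ℕ × Bool) × List (ℕ × Bool) × Bool)) :
    wordValue v (conjugateProduct c) = (c.map fun t => wordValue v t.1 *
      (if t.2.2 = true then wordValue v t.2.1 else (wordValue v t.2.1)⁻¹) *
        (wordValue v t.1)⁻¹).prod := by
  induction c with
  | nil => simp [conjugateProduct]
  | cons t c ih =>
    rw [conjugateProduct, List.flatMap_cons, wordValue_append, ← conjugateProduct, ih,
      List.map_cons, List.prod_cons, wordValue_append, wordValue_append, wordValue_invRev]
    split_ifs <;> simp [wordValue_invRev, mul_assoc]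

lemma Refutation.Refutes.not_holds {c : Refutation} {S : GroupSystem} (hc : c.Refutes S)
    {G : Type} [Group G] (v : ℕ → G) : ¬ ∀ l ∈ S, GroupLiteral.Holds v l := by
  intro h
  have h₁ := h _ hc.1
  rw [GroupLiteral.holds_iff] at h₁
  have h₂ : wordValue v c.1 = wordValue v (conjugateProduct c.2) := by
    rw [wordValue, wordValue, FreeGroup.reduce.exact hc.2.1]
  have h₃ : wordValue v (conjugateProduct c.2) = 1 := by
    rw [wordValue_conjugateProduct]
    refine List.prod_eq_one fun g hg => ?_
    obtain ⟨t, ht, rfl⟩ := List.mem_map.1 hg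
    have := h _ (hc.2.2 t ht)
    rw [GroupLiteral.holds_iff] at this
    simp [this.2 rfl]
  simp [h₂, h₃] at h₁

lemma wordValue_of (w : List (ℕ × Bool)) : wordValue FreeGroup.of w = FreeGroup.mk w := by
  rw [wordValue, FreeGroup.lift_of_eq_id]; rfl

lemma exists_conjugateProduct_of_mem_normalClosure {R : Set (List (ℕ × Bool))} {x : FreeGroup ℕ}
    (hx : x ∈ Subgroup.normalClosure (FreeGroup.mk '' R)) :
    ∃ c, FreeGroup.mk (conjugateProduct c) = x ∧ ∀ t ∈ c, t.2.1 ∈ R := by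
  -- As an element of the submonoid generated by the conjugates and their inverses, `x` is the
  -- product of a list; the inverses account for the signs.
  rw [Subgroup.normalClosure, ← Subgroup.mem_toSubmonoid, Subgroup.closure_toSubmonoid] at hx
  obtain ⟨L, hL, rfl⟩ := Submonoid.exists_list_of_mem_closure hx
  clear hx
  induction L with
  | nil => exact ⟨[], rfl, by simp⟩
  | cons g L ih =>
    obtain ⟨c, hc, hcR⟩ := ih fun y hy => hL y (by simp [hy])
    obtain ⟨t, ht, htR⟩ : ∃ t : List (ℕ × Bool) × List (ℕ × Bool) × Bool,
        FreeGroup.mk (conjugateProduct [t]) = g ∧ t.2.1 ∈ R := by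
      rcases hL g (by simp) with h | h
      all_goals
        obtain ⟨_, ⟨r, hr, rfl⟩, h⟩ := Group.mem_conjugatesOfSet_iff.1 h
        obtain ⟨k, hk⟩ := isConj_iff.1 h
      · refine ⟨(k.toWord, r, true), ?_, hr⟩
        rw [← wordValue_of, wordValue_conjugateProduct]
        simp [wordValue_of, FreeGroup.mk_toWord, hk, -FreeGroup.mul_mk, -FreeGroup.inv_mk]
      · refine ⟨(k.toWord, r, false), ?_, hr⟩
        rw [← wordValue_of, wordValue_conjugateProduct]
        simp [wordValue_of, FreeGroup.mk_toWord, -FreeGroup.inv_mk,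
          -FreeGroup.mul_mk]
        rw [← inv_inv g, ← hk]
        group
    refine ⟨t :: c, ?_, by simpa [htR] using hcR⟩
    rw [List.prod_cons, ← ht, ← hc, FreeGroup.mul_mk]
    simp [conjugateProduct]

/-- The group presented by the equations of `S` is the freest candidate. An inequation fails there
only if its word lies in the normal closure of the equations, which is a refutation. -/
lemma exists_holds_of_not_refutes {S : GroupSystem} (hS : ∀ c : Refutation, ¬ c.Refutes S) :
    ∃ (G : Type) (_ : Group G) (v : ℕ → G), ∀ l ∈ S, GroupLiteral.Holds v l := by
  let N := Subgroup.normalClosure (FreeGroup.mk '' {w : List (ℕ × Bool) | (w, true) ∈ S})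
  let x : ℕ → FreeGroup ℕ ⧸ N := fun i => QuotientGroup.mk' N (FreeGroup.of i)
  have hx : ∀ w, wordValue x w = 1 ↔ FreeGroup.mk w ∈ N := fun w => by
    have : FreeGroup.lift x = QuotientGroup.mk' N := by ext i; simp [x]
    rw [wordValue, this, QuotientGroup.mk'_apply, QuotientGroup.eq_one_iff]
  refine ⟨FreeGroup ℕ ⧸ N, inferInstance, x, fun l hl => ?_⟩
  rw [GroupLiteral.holds_iff, hx]
  rcases l with ⟨w, _ | _⟩
  · simp only [Bool.false_eq_true, iff_false]
    intro hw
    obtain ⟨c, hc, hcS⟩ := exists_conjugateProduct_of_mem_normalClosure hw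
    exact hS (w, c) ⟨hl, FreeGroup.reduce.sound hc.symm, hcS⟩
  · simp only [iff_true]
    exact Subgroup.subset_normalClosure ⟨w, hl, rfl⟩

end Refutation

/-! ### Herbrand's theorem -/

section Conjunction

/-- The disjunctive normal form of a conjunction. -/
def QFFormula.conj (ψ φ : QFFormula) : QFFormula :=
  ψ.flatMap fun S => φ.map fun S' => S ++ S'

lemma QFFormula.holds_conj {G : Type} [Group G] (v : ℕ → G) (ψ φ : QFFormula) :
    QFFormula.Holds v (ψ.conj φ) ↔ QFFormula.Holds v ψ ∧ QFFormula.Holds v φ := by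
  unfold QFFormula.Holds QFFormula.conj
  constructor
  · rintro ⟨_, hmem, h⟩
    obtain ⟨S, hS, hmem⟩ := List.mem_flatMap.1 hmem
    obtain ⟨S', hS', rfl⟩ := List.mem_map.1 hmem
    rw [List.forall_mem_append] at h
    exact ⟨⟨S, hS, h.1⟩, ⟨S', hS', h.2⟩⟩
  · rintro ⟨⟨S, hS, h⟩, ⟨S', hS', h'⟩⟩
    exact ⟨S ++ S', List.mem_flatMap.2 ⟨S, hS, List.mem_map.2 ⟨S', hS', rfl⟩⟩,
      List.forall_mem_append.2 ⟨h, h'⟩⟩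

/-- The conjunction of the first `n` Herbrand instances of `T`. -/
noncomputable def herbrandConj (T : Set PrenexFormula) (n : ℕ) : QFFormula :=
  n.rec (motive := fun _ => QFFormula) [[]] fun k ψ => ψ.conj (herbrandInstance T k)

lemma holds_herbrandConj {G : Type} [Group G] (v : ℕ → G) (T : Set PrenexFormula) (n : ℕ) :
    QFFormula.Holds v (herbrandConj T n) ↔ ∀ k < n, QFFormula.Holds v (herbrandInstance T k) := by
  induction n with
  | zero => simp [herbrandConj, QFFormula.holds_true]
  | succ n ih =>
    change QFFormula.Holds v ((herbrandConj T n).conj (herbrandInstance T n)) ↔ _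
    rw [QFFormula.holds_conj, ih, Nat.forall_lt_succ_right]

/-- Renaming of the variables of a system to even ones, which are not Skolem variables. -/
def GroupSystem.toEven (S : GroupSystem) : GroupSystem :=
  S.map fun l => (renameWord (fun i => 2 * i) l.1, l.2)

lemma GroupSystem.holds_toEven {G : Type} [Group G] (v : ℕ → G) (S : GroupSystem) :
    (∀ l ∈ S.toEven, GroupLiteral.Holds v l) ↔
      ∀ l ∈ S, GroupLiteral.Holds (fun i => v (2 * i)) l := by
  simp only [GroupSystem.toEven, List.forall_mem_map, GroupLiteral.holds_iff,
    wordValue_renameWord]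
  rfl

/-- A system is satisfiable in a countable model of `T`. -/
def SatisfiableIn (T : Set PrenexFormula) (S : GroupSystem) : Prop :=
  ∃ (G : Type) (_ : Group G) (_ : Countable G) (u : ℕ → G),
    (∀ σ ∈ T, Satisfies G σ) ∧ ∀ l ∈ S, GroupLiteral.Holds u l

lemma exists_list_forall_exists_mem {α β : Type*} {R : α → β → Prop} {L : List α}
    (h : ∀ a ∈ L, ∃ b, R a b) : ∃ C : List β, ∀ a ∈ L, ∃ b ∈ C, R a b := by
  induction L with
  | nil => exact ⟨[], by simp⟩
  | cons a L ih =>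
    obtain ⟨b, hb⟩ := h a (by simp)
    obtain ⟨C, hC⟩ := ih fun a' ha' => h a' (by simp [ha'])
    refine ⟨b :: C, List.forall_mem_cons.2 ⟨⟨b, by simp, hb⟩, fun a' ha' => ?_⟩⟩
    obtain ⟨c, hc, hR⟩ := hC a' ha'
    exact ⟨c, by simp [hc], hR⟩

/-- Herbrand's theorem: a system is unsatisfiable in the models of `T` if and only if this is
certified by finitely many Herbrand instances and finitely many refutations. -/
theorem not_satisfiableIn_iff (T : Set PrenexFormula) (S : GroupSystem) :
    ¬ SatisfiableIn T S ↔ ∃ p : ℕ × List Refutation,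
      ∀ S' ∈ herbrandConj T p.1, ∃ c ∈ p.2, c.Refutes (S' ++ S.toEven) := by
  constructor
  · intro hS
    -- Otherwise, for each `n` some disjunct together with `S` is solvable in some group, and
    -- compactness yields a countable model of `T` solving `S`.
    have hex : ∃ n, ∀ S' ∈ herbrandConj T n, ∃ c : Refutation, c.Refutes (S' ++ S.toEven) := by
      by_contra hcon
      have hcon' : ∀ n, ∃ S' ∈ herbrandConj T n,
          ∀ c : Refutation, ¬ c.Refutes (S' ++ S.toEven) := fun n => by
        by_contra hn
        exact hcon ⟨n, fun S' hS' => by_contra fun hc => hn ⟨S', hS', not_exists.1 hc⟩⟩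
      have hfin : ∀ n : ℕ, ∃ (G : Type) (_ : Group G) (v : ℕ → G),
          (∀ k < n, QFFormula.Holds v (herbrandInstance T k)) ∧
          ∀ l : {l // l ∈ S.toEven}, Encodable.encode l < n → GroupLiteral.Holds v l.1 := fun n => by
        obtain ⟨S', hS', hc⟩ := hcon' n
        obtain ⟨G, hG, v, hv⟩ := exists_holds_of_not_refutes hc
        rw [List.forall_mem_append] at hv
        exact ⟨G, hG, v, (holds_herbrandConj v T n).1 ⟨S', hS', hv.1⟩, fun l _ => hv.2 l.1 l.2⟩
      obtain ⟨G, hG, hG', v, hT, hv⟩ := exists_countable_model T Subtype.val hfin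
      exact hS ⟨G, hG, hG', _, hT, (GroupSystem.holds_toEven v S).1 fun l hl => hv ⟨l, hl⟩⟩
    obtain ⟨n, hn⟩ := hex
    obtain ⟨C, hC⟩ := exists_list_forall_exists_mem hn
    exact ⟨(n, C), hC⟩
  · rintro ⟨⟨n, C⟩, hC⟩ ⟨G, _, _, u, hT, hu⟩
    -- The solution `u` occupies the even variables, leaving the odd ones free for witnesses.
    obtain ⟨v, hvu, hv⟩ := exists_holds_herbrandInstance hT u
    obtain ⟨S', hS', h⟩ := (holds_herbrandConj v T n).2 fun k _ => hv k
    obtain ⟨c, -, hc⟩ := hC S' hS'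
    refine hc.not_holds v (List.forall_mem_append.2 ⟨h, ?_⟩)
    rw [GroupSystem.holds_toEven]
    simpa only [hvu] using hu

end Conjunction

/-! ### Recursive enumerability of unsatisfiability -/

section Computability

open Primrec

/-- Unbounded search through the codes of candidates `b`. -/
lemma REPred.exists_of_computablePred {α β : Type*} [Primcodable α] [Primcodable β]
    {R : α → β → Prop} (hR : ComputablePred fun p : α × β => R p.1 p.2) :
    REPred fun a => ∃ b, R a b := by
  classical
  have hf : Computable₂ fun (a : α) (n : ℕ) =>
      (Encodable.decode n : Option β).bind fun b => if R a b then some () else none := by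
    refine Computable.option_bind (Computable.decode.comp Computable.snd) ?_
    have h := hR.decide.comp
      ((Computable.fst.comp Computable.fst).pair Computable.snd :
        Computable fun p : (α × ℕ) × β => (p.1.1, p.2))
    exact (Computable.cond h (Computable.const (some ())) (Computable.const none)).of_eq
      fun p => by simp [Bool.cond_decide]
  refine (Partrec.rfindOpt hf).dom_re.of_eq fun a => ?_
  rw [Nat.rfindOpt_dom]
  constructor
  · rintro ⟨n, _, h⟩
    obtain ⟨b, -, hb⟩ := Option.bind_eq_some_iff.1 h
    exact ⟨b, by by_contra hR; simp [hR] at hb⟩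
  · rintro ⟨b, hb⟩
    exact ⟨Encodable.encode b, (), by simp [hb]⟩

lemma primrec_reduce : Primrec (FreeGroup.reduce : List (ℕ × Bool) → List (ℕ × Bool)) := by
  have hstep : Primrec₂ fun (_ : List (ℕ × Bool)) (q : (ℕ × Bool) × List (ℕ × Bool)) =>
      List.casesOn (motive := fun _ => List (ℕ × Bool)) q.2 [q.1] fun hd tl =>
        if q.1.1 = hd.1 ∧ q.1.2 = !hd.2 then tl else q.1 :: hd :: tl := by
    have hx : Primrec fun r : (List (ℕ × Bool) × ((ℕ × Bool) × List (ℕ × Bool))) ×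
        ((ℕ × Bool) × List (ℕ × Bool)) => r.1.2.1 := fst.comp (snd.comp fst)
    have hhd : Primrec fun r : (List (ℕ × Bool) × ((ℕ × Bool) × List (ℕ × Bool))) ×
        ((ℕ × Bool) × List (ℕ × Bool)) => r.2.1 := fst.comp snd
    have htl : Primrec fun r : (List (ℕ × Bool) × ((ℕ × Bool) × List (ℕ × Bool))) ×
        ((ℕ × Bool) × List (ℕ × Bool)) => r.2.2 := snd.comp snd
    have hite := Primrec.ite ((Primrec.eq.comp (fst.comp hx) (fst.comp hhd)).and
      (Primrec.eq.comp (snd.comp hx) (Primrec.not.comp (snd.comp hhd)))) htl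
      (list_cons.comp hx (list_cons.comp hhd htl))
    exact list_casesOn (snd.comp snd) (list_cons.comp (fst.comp snd) (Primrec.const [])) hite.to₂
  refine (list_foldr (f := fun w : List (ℕ × Bool) => w) Primrec.id
    (Primrec.const []) hstep).of_eq fun w => ?_
  induction w with
  | nil => rfl
  | cons p w ih => rw [List.foldr_cons, ih, FreeGroup.reduce.cons]

lemma primrec_invRev : Primrec (FreeGroup.invRev : List (ℕ × Bool) → List (ℕ × Bool)) :=
  list_reverse.comp (list_map Primrec.id
    ((fst.comp snd).pair (Primrec.not.comp (snd.comp snd))).to₂)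

lemma primrec_ite_bool {α σ : Type*} [Primcodable α] [Primcodable σ] {b : α → Bool} {f g : α → σ}
    (hb : Primrec b) (hf : Primrec f) (hg : Primrec g) :
    Primrec fun a => if b a = true then f a else g a :=
  Primrec.ite (Primrec.eq.comp hb (Primrec.const true)) hf hg

lemma primrec_conjugateProduct : Primrec conjugateProduct := by
  refine list_flatMap Primrec.id (list_append.comp (fst.comp snd) (list_append.comp
    (primrec_ite_bool (snd.comp (snd.comp snd)) (fst.comp (snd.comp snd))
      (primrec_invRev.comp (fst.comp (snd.comp snd)))) (primrec_invRev.comp (fst.comp snd))))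

lemma primrecRel_mem {α : Type*} [Primcodable α] : PrimrecRel fun (L : List α) (a : α) => a ∈ L := by
  refine (PrimrecRel.exists_mem_list (R := fun a b : α => a = b) Primrec.eq).of_eq fun L b => ?_
  simp

lemma primrecRel_refutes :
    PrimrecRel fun (c : Refutation) (S : GroupSystem) => c.Refutes S := by
  refine PrimrecPred.and ?_ (PrimrecPred.and ?_ ?_)
  · exact primrecRel_mem.comp snd ((fst.comp fst).pair (Primrec.const false))
  · exact Primrec.eq.comp (primrec_reduce.comp (fst.comp fst))
      (primrec_reduce.comp (primrec_conjugateProduct.comp (snd.comp fst)))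
  · exact (PrimrecRel.forall_mem_list
      (R := fun (t : List (ℕ × Bool) × List (ℕ × Bool) × Bool) (S : GroupSystem) =>
        (t.2.1, true) ∈ S)
      (primrecRel_mem.comp snd ((fst.comp (snd.comp fst)).pair (Primrec.const true)))).comp
      (snd.comp fst) snd

lemma primrec_conj : Primrec₂ QFFormula.conj := by
  refine list_flatMap fst (list_map (snd.comp fst) ?_)
  exact list_append.comp (snd.comp fst) snd

lemma primrec_toEven : Primrec GroupSystem.toEven := by
  refine list_map Primrec.id (Primrec.pair (list_map (fst.comp snd) ?_) (snd.comp snd))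
  exact (nat_mul.comp (Primrec.const 2) (fst.comp snd)).pair (snd.comp snd)

lemma primrec_subst :
    Primrec₂ (QFFormula.subst : List (List (ℕ × Bool)) → QFFormula → QFFormula) := by
  have hw : Primrec₂ fun (θ : List (List (ℕ × Bool))) (w : List (ℕ × Bool)) =>
      substWord (fun i => θ.getD i []) w := by
    have hget : Primrec fun q : (List (List (ℕ × Bool)) × List (ℕ × Bool)) × (ℕ × Bool) =>
        q.1.1.getD q.2.1 [] := (list_getD []).comp (fst.comp fst) (fst.comp snd)
    exact list_flatMap snd (primrec_ite_bool (snd.comp snd) hget (primrec_invRev.comp hget))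
  have hl : Primrec₂ fun (θ : List (List (ℕ × Bool))) (l : GroupLiteral) =>
      ((substWord (fun i => θ.getD i []) l.1, l.2) : GroupLiteral) :=
    (hw.comp fst (fst.comp snd)).pair (snd.comp snd)
  have hS : Primrec₂ fun (θ : List (List (ℕ × Bool))) (S : GroupSystem) =>
      (S.map fun l => ((substWord (fun i => θ.getD i []) l.1, l.2) : GroupLiteral)) :=
    list_map snd (hl.comp (fst.comp fst) snd)
  exact list_map snd (hS.comp (fst.comp fst) snd)

lemma primrec_skolemVar : Primrec₂ skolemVar :=
  nat_add.comp (nat_mul.comp (Primrec.const 2)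
    (Primrec.encode.comp (Primrec.pair fst snd))) (Primrec.const 1)

lemma primrecRel_isSkolemized : PrimrecRel IsSkolemized := by
  have h : PrimrecRel fun (i : ℕ) (s : PrenexFormula × List (List (ℕ × Bool))) =>
      ¬ s.1.1[i]? = some false ∨ s.2[i]? = some [(skolemVar s.1 (s.2.take i), true)] := by
    refine PrimrecPred.or (PrimrecPred.not (Primrec.eq.comp
      (list_getElem?.comp (fst.comp (fst.comp snd)) fst) (Primrec.const _)))
      (Primrec.eq.comp (list_getElem?.comp (snd.comp snd) fst) (option_some.comp ?_))
    exact list_cons.comp (Primrec.pair (primrec_skolemVar.comp (fst.comp snd)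
      (list_take.comp fst (snd.comp snd))) (Primrec.const true)) (Primrec.const [])
  have h' : PrimrecRel fun (n : ℕ) (s : PrenexFormula × List (List (ℕ × Bool))) => ∀ i < n,
      ¬ s.1.1[i]? = some false ∨ s.2[i]? = some [(skolemVar s.1 (s.2.take i), true)] :=
    (h.forall_mem_list.comp (list_range.comp fst) snd).of_eq (by simp)
  exact (h'.comp (list_length.comp snd) Primrec.id).of_eq fun s => by
    simp only [IsSkolemized, imp_iff_not_or, id]

lemma computable_herbrandInstance {T : Set PrenexFormula}
    (hT : ComputablePred fun σ => σ ∈ T) : Computable (herbrandInstance T) := by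
  classical
  let g : PrenexFormula × List (List (ℕ × Bool)) → QFFormula := fun s =>
    if s.2.length = s.1.1.length ∧ IsSkolemized s.1 s.2 then s.1.2.subst s.2 else [[]]
  have hg : Primrec g := by
    refine Primrec.ite (PrimrecPred.and ?_ ?_) ?_ (Primrec.const _)
    · exact Primrec.eq.comp (list_length.comp snd) (list_length.comp (fst.comp fst))
    · exact primrecRel_isSkolemized.comp fst snd
    · exact primrec_subst.comp snd (snd.comp fst)
  have hd : Computable fun p : ℕ × (PrenexFormula × List (List (ℕ × Bool))) =>
      decide (p.2.1 ∈ T) := hT.decide.comp (Computable.fst.comp Computable.snd)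
  -- Membership in `T` is merely computable, so it is tested outside the primitive recursive `g`.
  have h₁ : Computable₂ fun (_ : ℕ) (s : PrenexFormula × List (List (ℕ × Bool))) =>
      bif decide (s.1 ∈ T) then g s else [[]] :=
    Computable.cond hd (hg.to_comp.comp Computable.snd) (Computable.const _)
  refine (Computable.option_casesOn (Computable.decode (α := PrenexFormula × List (List (ℕ × Bool))))
    (Computable.const ([[]] : QFFormula)) h₁).of_eq fun k => ?_
  unfold herbrandInstance
  split <;> rename_i h <;> rw [h]
  simp only [Bool.cond_decide, g]

lemma computable_herbrandConj {T : Set PrenexFormula}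
    (hT : ComputablePred fun σ => σ ∈ T) : Computable (herbrandConj T) := by
  have h : Computable₂ fun (_ : ℕ) (p : ℕ × QFFormula) => p.2.conj (herbrandInstance T p.1) :=
    primrec_conj.to_comp.comp (Computable.snd.comp Computable.snd)
      ((computable_herbrandInstance hT).comp (Computable.fst.comp Computable.snd))
  exact (Computable.nat_rec Computable.id (Computable.const ([[]] : QFFormula)) h).of_eq
    fun n => rfl

/-- Unsatisfiability in the models of a recursive theory is recursively enumerable. -/
theorem rePred_not_satisfiableIn {T : Set PrenexFormula} (hT : ComputablePred fun σ => σ ∈ T)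
    {α : Type*} [Primcodable α] {S : α → GroupSystem} (hS : Computable S) :
    REPred fun a => ¬ SatisfiableIn T (S a) := by
  classical
  have h₁ : PrimrecRel fun (S' : GroupSystem) (q : List Refutation × GroupSystem) =>
      ∃ c ∈ q.1, c.Refutes (S' ++ q.2) :=
    ((PrimrecRel.exists_mem_list (R := fun (c : Refutation) (q : GroupSystem × GroupSystem) =>
      c.Refutes (q.1 ++ q.2)) (primrecRel_refutes.comp fst
        (list_append.comp (fst.comp snd) (snd.comp snd)))).comp (fst.comp snd)
        (Primrec.pair fst (snd.comp snd)))
  have h₂ : PrimrecPred fun r : QFFormula × (List Refutation × GroupSystem) =>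
      ∀ S' ∈ r.1, ∃ c ∈ r.2.1, c.Refutes (S' ++ r.2.2) := h₁.forall_mem_list
  have hmap : Computable fun q : α × (ℕ × List Refutation) =>
      (herbrandConj T q.2.1, q.2.2, (S q.1).toEven) :=
    ((computable_herbrandConj hT).comp (Computable.fst.comp Computable.snd)).pair
      ((Computable.snd.comp Computable.snd).pair
        (primrec_toEven.to_comp.comp (hS.comp Computable.fst)))
  refine REPred.of_eq (REPred.exists_of_computablePred (β := ℕ × List Refutation)
    (R := fun a p => ∀ S' ∈ herbrandConj T p.1, ∃ c ∈ p.2, c.Refutes (S' ++ (S a).toEven))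
    (h₂.computablePred.decide.comp hmap).computablePred)
    fun a => (not_satisfiableIn_iff T (S a)).symm

/-- A finite group has solvable word problem. -/
theorem hasSolvableWordProblem_of_finite (G : Type) [Group G] [Finite G] :
    HasSolvableWordProblem G := by
  classical
  obtain ⟨n, ⟨e⟩⟩ := Finite.exists_equiv_fin G
  let _ : Primcodable G := Primcodable.ofEquiv (Fin n) e
  refine ⟨n, e.symm, ?_, ?_⟩
  · rw [e.symm.surjective.range_eq, Subgroup.closure_univ]
  -- Every function on a finite type is primitive recursive, so words can be evaluated by a fold.
  · have hstep : Primrec₂ fun (_ : List (Fin n × Bool)) (q : (Fin n × Bool) × G) =>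
        (if q.1.2 = true then e.symm q.1.1 else (e.symm q.1.1)⁻¹) * q.2 :=
      (Primrec.dom_finite (fun q : (Fin n × Bool) × G =>
        (if q.1.2 = true then e.symm q.1.1 else (e.symm q.1.1)⁻¹) * q.2)).comp snd
    have hval : Primrec fun w : List (Fin n × Bool) => wordValue e.symm w := by
      refine (list_foldr (f := fun w : List (Fin n × Bool) => w) Primrec.id
        (Primrec.const (1 : G)) hstep).of_eq fun w => ?_
      induction w with
      | nil => simp
      | cons p w ih => rw [List.foldr_cons, ih, wordValue_cons]
    exact (Primrec.eq.comp hval (Primrec.const 1)).computablePred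

end Computability

/-! ### Finite presentations as finite systems -/

section Presentation

/-- A tuple satisfies a finite list of equations and inequations. -/
def TupleSatisfies {ι G : Type} [Group G] (t : ι → G) (S : List (List (ι × Bool) × Bool)) : Prop :=
  ∀ l ∈ S, (wordValue t l.1 = 1 ↔ l.2 = true)

lemma wordValue_toWord {ι G : Type} [DecidableEq ι] [Group G] (t : ι → G) (x : FreeGroup ι) :
    wordValue t x.toWord = FreeGroup.lift t x := by
  rw [wordValue, FreeGroup.mk_toWord]

/-- The homomorphisms from a finitely presented group that are injective on a given finite set
are described by a finite list of equations and inequations. -/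
theorem exists_tupleSatisfies_iff (G : Type) [Group G] (hG : Group.IsFinitelyPresented G)
    {X : Set G} (hX : X.Finite) :
    ∃ (n : ℕ) (s : Fin n → G) (S : List (List (Fin n × Bool) × Bool)),
      Subgroup.closure (Set.range s) = ⊤ ∧
      ∀ (H : Type) [Group H] (t : Fin n → H),
        TupleSatisfies t S ↔ ∃ φ : G →* H, φ ∘ s = t ∧ Set.InjOn φ X := by
  obtain ⟨n, q, hq, R, hR, hker⟩ := hG
  let x : G → FreeGroup (Fin n) := Function.surjInv hq
  have hx : ∀ g, q (x g) = g := Function.surjInv_eq hq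
  -- Relators become equations; each pair of distinct elements of `X`, lifted by `x`, becomes an
  -- inequation.
  have hA : ((fun r : FreeGroup (Fin n) => (r.toWord, true)) '' R ∪
      (fun p : G × G => ((x p.1 * (x p.2)⁻¹).toWord, false)) '' X.offDiag).Finite :=
    (hR.image _).union (hX.offDiag.image _)
  have hs : FreeGroup.lift (fun i => q (FreeGroup.of i)) = q := by ext i; simp
  refine ⟨n, fun i => q (FreeGroup.of i), hA.toFinset.toList, ?_, fun H _ t => ?_⟩
  · rw [← FreeGroup.range_lift_eq_closure, hs]
    exact MonoidHom.range_eq_top.2 hq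
  have hsat : TupleSatisfies t hA.toFinset.toList ↔ (∀ r ∈ R, FreeGroup.lift t r = 1) ∧
      ∀ p ∈ X.offDiag, FreeGroup.lift t (x p.1 * (x p.2)⁻¹) ≠ 1 := by
    simp only [TupleSatisfies, Finset.mem_toList, Set.Finite.mem_toFinset, Set.mem_union, or_imp,
      forall_and, Set.forall_mem_image, wordValue_toWord, iff_true, Bool.false_eq_true, iff_false,
      ne_eq]
  rw [hsat]
  constructor
  · rintro ⟨h₁, h₂⟩
    have hle : q.ker ≤ (FreeGroup.lift t).ker := by
      rw [← hker]
      exact Subgroup.normalClosure_le_normal fun r hr => h₁ r hr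
    let φ : G →* H := q.liftOfSurjective hq ⟨FreeGroup.lift t, hle⟩
    have hφ : ∀ y, φ (q y) = FreeGroup.lift t y := fun y =>
      q.liftOfRightInverse_comp_apply _ (Function.rightInverse_surjInv hq) ⟨_, hle⟩ y
    refine ⟨φ, funext fun i => by simp [hφ], fun g hg g' hg' h => ?_⟩
    by_contra hne
    refine h₂ (g, g') ⟨hg, hg', hne⟩ ?_
    rw [← hφ, map_mul, map_inv, hx, hx, map_mul, map_inv, h, mul_inv_cancel]
  · rintro ⟨φ, rfl, hφ⟩
    have hlift : ∀ y, FreeGroup.lift (φ ∘ fun i => q (FreeGroup.of i)) y = φ (q y) := fun y => by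
      have : FreeGroup.lift (φ ∘ fun i => q (FreeGroup.of i)) = φ.comp q := by ext i; simp
      rw [this]; rfl
    refine ⟨fun r hr => ?_, fun p hp h => hp.2.2 (hφ hp.1 hp.2.1 ?_)⟩
    · have : r ∈ q.ker := hker ▸ Subgroup.subset_normalClosure hr
      rw [hlift, MonoidHom.mem_ker.1 this, map_one]
    · rw [hlift, map_mul, map_inv, hx, hx, map_mul, map_inv, mul_inv_eq_one] at h
      exact h

lemma hasSolvableWordProblem_closure {G : Type} [Group G] {n : ℕ} {t : Fin n → G}
    (ht : ComputablePred fun w => wordValue t w = 1) :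
    HasSolvableWordProblem (Subgroup.closure (Set.range t)) := by
  let t' : Fin n → Subgroup.closure (Set.range t) := fun i =>
    ⟨t i, Subgroup.subset_closure ⟨i, rfl⟩⟩
  have ht' : ((↑) : Subgroup.closure (Set.range t) → G) ∘ t' = t := rfl
  refine ⟨n, t', ?_, ht.of_eq fun w => ?_⟩
  · rw [← Subgroup.closure_closure_coe_preimage (k := Set.range t)]
    congr 1
    ext g
    simp [t', Subtype.ext_iff]
  · have := map_wordValue (Subgroup.closure (Set.range t)).subtype t' w
    change _ = wordValue t w at this
    rw [← this]
    simp

end Presentation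

/-! ### Consequences of the hypotheses on P -/

section Properties

variable {P : GroupProperty}

lemma countable_of_closure_eq_top {G : Type} [Group G] {n : ℕ} {s : Fin n → G}
    (hs : Subgroup.closure (Set.range s) = ⊤) : Countable G :=
  Function.Surjective.countable (f := wordValue s) fun _ =>
    exists_wordValue_of_mem_closure s (hs ▸ Subgroup.mem_top _)

/-- A `GroupProperty` need not be isomorphism invariant; on countable groups the axioms make it so.
-/
lemma RecursivelyAxiomatizable.of_mulEquiv (hax : RecursivelyAxiomatizable P) {G H : Type}
    [Group G] [Group H] [Countable G] (e : G ≃* H) (hG : P G) : P H := by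
  obtain ⟨T, -, -, hT⟩ := hax
  have : Countable H := e.symm.injective.countable
  exact (hT H).2 fun σ hσ => (satisfies_mulEquiv e σ).1 ((hT G).1 hG σ hσ)

lemma RecursivelyAxiomatizable.of_injective (hax : RecursivelyAxiomatizable P)
    (hsub : ClosedUnderSubgroups P) {K G : Type} [Group K] [Group G] [Countable G] {f : K →* G}
    (hf : Function.Injective f) (hG : P G) : P K :=
  hax.of_mulEquiv (MonoidHom.ofInjective hf).symm (hsub G hG f.range)

/-- A strongly undecidable property closed under subgroups yields a system that is solvable in some
infinite group with the property, and whose solutions in groups with the property all have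
undecidable relations. -/
theorem StronglyUndecidable.exists_system (hundec : StronglyUndecidable P)
    (hsub : ClosedUnderSubgroups P) :
    ∃ (n : ℕ) (S : List (List (Fin n × Bool) × Bool)),
      (∃ (H : Type) (_ : Group H) (_ : Countable H) (t : Fin n → H), P H ∧ TupleSatisfies t S) ∧
      ∀ (H : Type) [Group H] [Countable H] (t : Fin n → H), P H → TupleSatisfies t S →
        Infinite H ∧ ¬ ComputablePred fun w => wordValue t w = 1 := by
  obtain ⟨G, hG, X, hfp, hX, ⟨H₀, hH₀, hPH₀, φ₀, hsurj, hinj⟩, hbad⟩ := hundec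
  obtain ⟨n, s, S, hs, hS⟩ := exists_tupleSatisfies_iff G hfp hX
  have := countable_of_closure_eq_top hs
  refine ⟨n, S, ⟨H₀, hH₀, hsurj.countable, φ₀ ∘ s, hPH₀, (hS _ _).2 ⟨φ₀, rfl, hinj⟩⟩, ?_⟩
  intro H _ _ t hPH ht
  obtain ⟨φ, rfl, hφ⟩ := (hS _ _).1 ht
  -- Strong undecidability concerns surjections, so it is applied to the image of `φ`, which has `P`
  -- as a subgroup.
  have hns : ¬ HasSolvableWordProblem φ.range := hbad φ.range (hsub H hPH _)
    ⟨φ.rangeRestrict, φ.rangeRestrict_surjective, fun x hx y hy h => hφ hx hy (by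
      simpa using congrArg Subtype.val h)⟩
  refine ⟨?_, fun hcomp => hns ?_⟩
  · by_contra hfin
    rw [not_infinite_iff_finite] at hfin
    exact hns (hasSolvableWordProblem_of_finite _)
  · have : φ.range = Subgroup.closure (Set.range (φ ∘ s)) := by
      rw [Set.range_comp, ← MonoidHom.map_closure, hs, MonoidHom.range_eq_map]
    rw [this]
    exact hasSolvableWordProblem_closure hcomp

end Properties

/-! ### Enumerating countably infinite groups -/

section Enumerations

/-- The elements of an enumerated group. -/
def EnumeratedGroup.enum (N : EnumeratedGroup) (i : ℕ) : N.Carrier := i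

/-- The index of an element of an enumerated group. -/
def EnumeratedGroup.index (N : EnumeratedGroup) (a : N.Carrier) : ℕ := a

lemma EnumeratedGroup.enum_index (N : EnumeratedGroup) (a : N.Carrier) :
    N.enum (N.index a) = a := rfl

instance (N : EnumeratedGroup) : Countable N.Carrier := inferInstanceAs (Countable ℕ)

instance (N : EnumeratedGroup) : Infinite N.Carrier := inferInstanceAs (Infinite ℕ)

/-- The complements of the initial segment and of its image are both countably infinite, so any
bijection between them will do. -/
lemma exists_equiv_extending {M : Type*} [Countable M] [Infinite M] {u : ℕ → M} {K : ℕ}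
    (hu : Set.InjOn u (Set.Iio K)) : ∃ b : ℕ ≃ M, ∀ i < K, b i = u i := by
  classical
  let s : Set ℕ := Set.Iio K
  have hs : Infinite ↑sᶜ := (Set.finite_Iio K).infinite_compl.to_subtype
  have ht : Infinite ↑(u '' s)ᶜ := ((Set.finite_Iio K).image u).infinite_compl.to_subtype
  obtain ⟨e₂⟩ := nonempty_equiv_of_countable (α := ↑sᶜ) (β := ↑(u '' s)ᶜ)
  let e₁ : s ≃ u '' s := Equiv.Set.imageOfInjOn u s hu
  refine ⟨(Equiv.Set.sumCompl s).symm.trans ((Equiv.sumCongr e₁ e₂).trans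
    (Equiv.Set.sumCompl (u '' s))), fun i hi => ?_⟩
  rw [Equiv.trans_apply, Equiv.Set.sumCompl_symm_apply_of_mem (show i ∈ s from hi)]
  simp [e₁, Equiv.Set.imageOfInjOn]

/-- An injective finite partial enumeration of a countably infinite group extends to an
enumeration. -/
lemma exists_enumeratedGroup {M : Type} [Group M] [Countable M] [Infinite M] {u : ℕ → M} {K : ℕ}
    (hu : Set.InjOn u (Set.Iio K)) :
    ∃ (N : EnumeratedGroup) (e : N.Carrier ≃* M), ∀ i < K, e (N.enum i) = u i := by
  obtain ⟨b, hb⟩ := exists_equiv_extending hu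
  let N : EnumeratedGroup := ⟨(fun p => b.symm (b p.1 * b p.2), fun a => b.symm (b a)⁻¹,
    b.symm 1), by simp [mul_assoc], by simp, by simp, by simp, by simp⟩
  let e : N.Carrier ≃* M :=
    { toFun := b, invFun := b.symm, left_inv := b.left_inv, right_inv := b.right_inv
      map_mul' := fun x y => b.apply_symm_apply _ }
  exact ⟨N, e, hb⟩

lemma MulEquiv.wordValue_eq_one_iff {ι G H : Type} [Group G] [Group H] (e : G ≃* H) (v : ι → G)
    (w : List (ι × Bool)) : wordValue (e ∘ v) w = 1 ↔ wordValue v w = 1 := by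
  have := map_wordValue e.toMonoidHom v w
  change e _ = wordValue (e ∘ v) w at this
  rw [← this, map_eq_one_iff e e.injective]

end Enumerations

/-! ### The topology of the space; closedness of P -/

section Topology

open Filter Topology

/-- With `A` discrete, `f` is locally constant, so near each point its value can be frozen. -/
lemma continuous_apply_apply {X A B : Type*} [TopologicalSpace X] [TopologicalSpace A]
    [DiscreteTopology A] [TopologicalSpace B] {F : X → A → B} (hF : ∀ a, Continuous fun x => F x a)
    {f : X → A} (hf : Continuous f) : Continuous fun x => F x (f x) := by
  refine continuous_iff_continuousAt.2 fun x₀ => (hF (f x₀)).continuousAt.congr ?_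
  have h : ∀ᶠ x in 𝓝 x₀, f x = f x₀ := hf.continuousAt ((isOpen_discrete {f x₀}).mem_nhds rfl)
  filter_upwards [h] with x hx
  rw [hx]

lemma EnumeratedGroup.isInducing_val : IsInducing fun N : EnumeratedGroup => N.val := ⟨rfl⟩

lemma EnumeratedGroup.continuous_mul (a b : ℕ) :
    Continuous fun N : EnumeratedGroup => N.val.1 (a, b) :=
  (continuous_apply _).comp (continuous_fst.comp isInducing_val.continuous)

lemma EnumeratedGroup.continuous_inv (a : ℕ) :
    Continuous fun N : EnumeratedGroup => N.val.2.1 a :=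
  (continuous_apply _).comp
    (continuous_fst.comp (continuous_snd.comp isInducing_val.continuous))

lemma EnumeratedGroup.continuous_one : Continuous fun N : EnumeratedGroup => N.val.2.2 :=
  continuous_snd.comp (continuous_snd.comp isInducing_val.continuous)

lemma continuous_index_wordValue (w : List (ℕ × Bool)) :
    Continuous fun N : EnumeratedGroup => N.index (wordValue N.enum w) := by
  induction w with
  | nil =>
    simp only [wordValue_nil]
    exact EnumeratedGroup.continuous_one
  | cons p w ih =>
    simp only [wordValue_cons]
    rcases p with ⟨i, _ | _⟩
    · exact continuous_apply_apply (F := fun (N : EnumeratedGroup) q => N.val.1 q)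
        (fun q => EnumeratedGroup.continuous_mul q.1 q.2)
        ((EnumeratedGroup.continuous_inv i).prodMk ih)
    · exact continuous_apply_apply (F := fun (N : EnumeratedGroup) c => N.val.1 (i, c))
        (fun c => EnumeratedGroup.continuous_mul i c) ih

lemma isClopen_setOf_wordValue_eq_one (w : List (ℕ × Bool)) :
    IsClopen {N : EnumeratedGroup | wordValue N.enum w = 1} :=
  (isClopen_discrete {p : ℕ × ℕ | p.1 = p.2}).preimage
    ((continuous_index_wordValue w).prodMk EnumeratedGroup.continuous_one)

lemma isClopen_setOf_wordValue_iff (w : List (ℕ × Bool)) (p : Prop) :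
    IsClopen {N : EnumeratedGroup | wordValue N.enum w = 1 ↔ p} := by
  by_cases hp : p
  · simp only [hp, iff_true]
    exact isClopen_setOf_wordValue_eq_one w
  · simp only [hp, iff_false]
    exact (isClopen_setOf_wordValue_eq_one w).compl

lemma EnumeratedGroup.mul_eq_iff (N : EnumeratedGroup) (a b c : ℕ) :
    N.val.1 (a, b) = c ↔ wordValue N.enum [(a, true), (b, true), (c, false)] = 1 := by
  simp only [wordValue_cons, wordValue_nil, if_true, Bool.false_eq_true, if_false, mul_one]
  rw [← mul_assoc, mul_inv_eq_one]
  rfl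

lemma EnumeratedGroup.inv_eq_iff (N : EnumeratedGroup) (a b : ℕ) :
    N.val.2.1 a = b ↔ wordValue N.enum [(a, true), (b, true)] = 1 := by
  simp only [wordValue_cons, wordValue_nil, if_true, mul_one]
  rw [mul_eq_one_iff_inv_eq]
  rfl

lemma EnumeratedGroup.one_eq_iff (N : EnumeratedGroup) (a : ℕ) :
    N.val.2.2 = a ↔ wordValue N.enum [(a, true)] = 1 := by
  rw [wordValue_letter, eq_comm]
  rfl

/-- A neighborhood of an enumerated group contains all groups satisfying the same relations
among finitely many. -/
lemma exists_finite_words_of_mem_nhds {N₀ : EnumeratedGroup} {U : Set EnumeratedGroup}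
    (hU : U ∈ 𝓝 N₀) : ∃ W : Set (List (ℕ × Bool)), W.Finite ∧ ∀ N : EnumeratedGroup,
      (∀ w ∈ W, (wordValue N.enum w = 1 ↔ wordValue N₀.enum w = 1)) → N ∈ U := by
  let F : Filter EnumeratedGroup := ⨅ w : List (ℕ × Bool),
    𝓟 {N | wordValue N.enum w = 1 ↔ wordValue N₀.enum w = 1}
  have hF : ∀ w, ∀ᶠ N in F, (wordValue (EnumeratedGroup.enum N) w = 1 ↔ wordValue N₀.enum w = 1) :=
    fun w => mem_iInf_of_mem w (mem_principal_self _)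
  -- Each value of multiplication, inversion or the identity is fixed by the triviality of a single
  -- word.
  have hle : F ≤ 𝓝 N₀ := by
    have h : Tendsto (fun N : EnumeratedGroup => N.val) F (𝓝 N₀.val) := by
      refine Tendsto.prodMk_nhds (tendsto_pi_nhds.2 fun p => ?_)
        (Tendsto.prodMk_nhds (tendsto_pi_nhds.2 fun a => ?_) ?_)
      · refine tendsto_nhds_of_eventually_eq ?_
        filter_upwards [hF [(p.1, true), (p.2, true), (N₀.val.1 p, false)]] with N hN
        exact (N.mul_eq_iff _ _ _).2 (hN.2 ((N₀.mul_eq_iff _ _ _).1 rfl))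
      · refine tendsto_nhds_of_eventually_eq ?_
        filter_upwards [hF [(a, true), (N₀.val.2.1 a, true)]] with N hN
        exact (N.inv_eq_iff _ _).2 (hN.2 ((N₀.inv_eq_iff _ _).1 rfl))
      · refine tendsto_nhds_of_eventually_eq ?_
        filter_upwards [hF [(N₀.val.2.2, true)]] with N hN
        exact (N.one_eq_iff _).2 (hN.2 ((N₀.one_eq_iff _).1 rfl))
    rw [EnumeratedGroup.isInducing_val.nhds_eq_comap]
    exact tendsto_iff_comap.1 h
  obtain ⟨W, hW, hWU⟩ := (hasBasis_iInf_principal_finite _).mem_iff.1 (hle hU)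
  exact ⟨W, hW, fun N hN => hWU (Set.mem_iInter₂.2 hN)⟩

/-- The group axioms are closed conditions in a countable product of discrete countable spaces. -/
instance : PolishSpace EnumeratedGroup := by
  have hmul : ∀ f g : (ℕ × ℕ → ℕ) × (ℕ → ℕ) × ℕ → ℕ, Continuous f → Continuous g →
      Continuous fun x : (ℕ × ℕ → ℕ) × (ℕ → ℕ) × ℕ => x.1 (f x, g x) := fun f g hf hg =>
    continuous_apply_apply (F := fun (x : (ℕ × ℕ → ℕ) × (ℕ → ℕ) × ℕ) q => x.1 q)
      (fun q => (continuous_apply q).comp continuous_fst) (hf.prodMk hg)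
  have hinv : ∀ m, Continuous fun x : (ℕ × ℕ → ℕ) × (ℕ → ℕ) × ℕ => x.2.1 m := fun m =>
    (continuous_apply m).comp (continuous_fst.comp continuous_snd)
  have hone : Continuous fun x : (ℕ × ℕ → ℕ) × (ℕ → ℕ) × ℕ => x.2.2 :=
    continuous_snd.comp continuous_snd
  have hc : ∀ m : ℕ, Continuous fun _ : (ℕ × ℕ → ℕ) × (ℕ → ℕ) × ℕ => m :=
    fun _ => continuous_const
  refine IsClosedEmbedding.polishSpace (f := fun N : EnumeratedGroup => N.val)
    ⟨⟨EnumeratedGroup.isInducing_val, Subtype.val_injective⟩, ?_⟩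
  have hclosed := (isClosed_iInter fun m => isClosed_iInter fun n => isClosed_iInter fun p =>
    isClosed_eq (hmul _ _ (hmul _ _ (hc m) (hc n)) (hc p))
      (hmul _ _ (hc m) (hmul _ _ (hc n) (hc p)))).inter <|
    (isClosed_iInter fun m => isClosed_eq (hmul _ _ hone (hc m)) (hc m)).inter <|
    (isClosed_iInter fun m => isClosed_eq (hmul _ _ (hc m) hone) (hc m)).inter <|
    (isClosed_iInter fun m => isClosed_eq (hmul _ _ (hinv m) (hc m)) hone).inter <|
    isClosed_iInter fun m => isClosed_eq (hmul _ _ (hc m) (hinv m)) hone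
  convert! hclosed using 1
  ext x
  simp only [Set.mem_inter_iff, Set.mem_iInter]
  exact ⟨fun ⟨N, hN⟩ => hN ▸ N.2, fun h => ⟨⟨x, h⟩, rfl⟩⟩

/-- Compactness is applied to the diagram of a limit `N`: each finite part holds in some nearby
group with `P`, so `N` embeds in a countable model of the axioms. -/
theorem isClosed_setOf_property {P : GroupProperty} (hax : RecursivelyAxiomatizable P)
    (hsub : ClosedUnderSubgroups P) : IsClosed {N : EnumeratedGroup | P N.Carrier} := by
  refine isClosed_of_closure_subset fun N hN => ?_
  have hax' := hax
  obtain ⟨T, -, -, hT⟩ := hax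
  classical
  obtain ⟨G, hG, hG', v, hGT, hv⟩ := exists_countable_model T
    (fun w : List (ℕ × Bool) =>
      ((renameWord (fun i => 2 * i) w, decide (wordValue N.enum w = 1)) : GroupLiteral)) fun n => by
    have hfin : {w : List (ℕ × Bool) | Encodable.encode w < n}.Finite :=
      (Set.finite_Iio n).preimage Encodable.encode_injective.injOn
    have hopen : IsOpen (⋂ w ∈ {w : List (ℕ × Bool) | Encodable.encode w < n},
        {N' : EnumeratedGroup | wordValue N'.enum w = 1 ↔ wordValue N.enum w = 1}) :=
      hfin.isOpen_biInter fun w _ => (isClopen_setOf_wordValue_iff w _).isOpen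
    obtain ⟨N', hN', hP⟩ := mem_closure_iff.1 hN _ hopen (by simp)
    obtain ⟨v, hvu, hv⟩ := exists_holds_herbrandInstance ((hT N'.Carrier).1 hP) N'.enum
    refine ⟨N'.Carrier, inferInstance, v, fun k _ => hv k, fun w hw => ?_⟩
    have := Set.mem_iInter₂.1 hN' w hw
    rw [GroupLiteral.holds_iff, wordValue_renameWord, decide_eq_true_iff,
      show v ∘ (fun i => 2 * i) = N'.enum from funext hvu]
    exact this
  have hv' : ∀ w, wordValue (v ∘ fun i => 2 * i) w = 1 ↔ wordValue N.enum w = 1 := fun w => by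
    have := hv w
    rwa [GroupLiteral.holds_iff, wordValue_renameWord, decide_eq_true_iff] at this
  -- The even variables name the elements of `N`. The relations in the diagram make `f` a
  -- homomorphism, the non-relations make it injective.
  let f : N.Carrier →* G := MonoidHom.mk' (fun a => v (2 * N.index a)) fun a b => by
    have := (hv' _).2 ((N.mul_eq_iff (N.index a) (N.index b) _).1 rfl)
    simp only [wordValue_cons, wordValue_nil, if_true, Bool.false_eq_true, if_false, mul_one] at this
    rw [← mul_assoc, mul_inv_eq_one] at this
    exact this.symm
  have hf : Function.Injective f := (injective_iff_map_eq_one f).2 fun a ha => by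
    have := (hv' [(N.index a, true)]).1 (by rw [wordValue_letter]; exact ha)
    rwa [wordValue_letter, N.enum_index] at this
  exact hax'.of_injective hsub hf ((hT G).2 hGT)

theorem polishSpace_enumeratedGroupsWith {P : GroupProperty} (hax : RecursivelyAxiomatizable P)
    (hsub : ClosedUnderSubgroups P) : PolishSpace (EnumeratedGroupsWith P) :=
  (isClosed_setOf_property hax hsub).polishSpace

end Topology

/-! ### Isolated relations are decidable -/

section Isolation

variable {P : GroupProperty}

lemma exists_variable_bound {n : ℕ} {W : Set (List (ℕ × Bool))} (hW : W.Finite) (d : Fin n → ℕ) :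
    ∃ K, (∀ w ∈ W, ∀ p ∈ w, p.1 < K) ∧ ∀ i, d i < K := by
  have hfin : ((⋃ w ∈ W, Prod.fst '' {p : ℕ × Bool | p ∈ w}) ∪ Set.range d).Finite :=
    (hW.biUnion fun w _ => (List.finite_toSet w).image _).union (Set.finite_range d)
  obtain ⟨B, hB⟩ := hfin.bddAbove
  refine ⟨B + 1, fun w hw p hp => Nat.lt_succ_of_le (hB (Or.inl ?_)),
    fun i => Nat.lt_succ_of_le (hB (Or.inr ⟨i, rfl⟩))⟩
  exact Set.mem_biUnion hw ⟨p, hp, rfl⟩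

/-- If finitely many relations and non-relations of an enumerated group `N₀` with `P` determine,
among the enumerated groups with `P`, all the relations of a tuple, and if this tuple satisfies a
system without solutions in finite groups with `P`, then the relations of the tuple are
decidable. -/
theorem computablePred_relations_of_isolated (hax : RecursivelyAxiomatizable P)
    {N₀ : EnumeratedGroup} (hN₀ : P N₀.Carrier) {n : ℕ} (d : Fin n → ℕ)
    {W : Set (List (ℕ × Bool))} (hW : W.Finite)
    (hiso : ∀ N : EnumeratedGroup, P N.Carrier →
      (∀ w ∈ W, (wordValue N.enum w = 1 ↔ wordValue N₀.enum w = 1)) →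
      ∀ w, (wordValue (N.enum ∘ d) w = 1 ↔ wordValue (N₀.enum ∘ d) w = 1))
    {S : List (List (Fin n × Bool) × Bool)} (hS₀ : TupleSatisfies (N₀.enum ∘ d) S)
    (hS : ∀ (H : Type) [Group H] [Countable H] (t : Fin n → H), P H → TupleSatisfies t S →
      Infinite H) :
    ComputablePred fun w => wordValue (N₀.enum ∘ d) w = 1 := by
  classical
  have hax' := hax
  obtain ⟨T, -, hTc, hT⟩ := hax
  obtain ⟨K, hKW, hKd⟩ := exists_variable_bound hW d
  -- `R₁` is the isolating data. `R₂` makes the first `K` values distinct, as an enumeration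
  -- requires, and `R₃` forces the ambient group to be infinite.
  let R₁ : GroupSystem := hW.toFinset.toList.map fun w => (w, decide (wordValue N₀.enum w = 1))
  let R₂ : GroupSystem := (List.range K ×ˢ List.range K).map fun p =>
    ([(p.1, true), (p.2, false)], decide (p.1 = p.2))
  let R₃ : GroupSystem := S.map fun l => (renameWord d l.1, l.2)
  have hR₁ : ∀ (M : Type) [Group M] (u : ℕ → M), (∀ l ∈ R₁, GroupLiteral.Holds u l) ↔
      ∀ w ∈ W, (wordValue u w = 1 ↔ wordValue N₀.enum w = 1) := fun M _ u => by
    simp [R₁, GroupLiteral.holds_iff, -Prod.forall]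
  have hR₂ : ∀ (M : Type) [Group M] (u : ℕ → M), (∀ l ∈ R₂, GroupLiteral.Holds u l) ↔
      ∀ i < K, ∀ j < K, (u i = u j ↔ i = j) := fun M _ u => by
    simp only [R₂, GroupLiteral.holds_iff, List.forall_mem_map,
      Prod.forall, wordValue_cons, wordValue_nil, mul_one, if_true,
      Bool.false_eq_true, if_false, mul_inv_eq_one, decide_eq_true_iff]
    refine ⟨fun h i hi j hj => h i j (List.pair_mem_product.2 ⟨List.mem_range.2 hi,
      List.mem_range.2 hj⟩), fun h i j hij => ?_⟩
    obtain ⟨hi, hj⟩ := List.pair_mem_product.1 hij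
    exact h i (List.mem_range.1 hi) j (List.mem_range.1 hj)
  have hR₃ : ∀ (M : Type) [Group M] (u : ℕ → M), (∀ l ∈ R₃, GroupLiteral.Holds u l) ↔
      TupleSatisfies (u ∘ d) S := fun M _ u => by
    simp only [R₃, GroupLiteral.holds_iff, List.forall_mem_map, wordValue_renameWord]
    rfl
  -- The hypothesis `hiso` covers only enumerated groups, so the first `K` values of `u` are
  -- extended to an enumeration of `M`; the words in `W` and the tuple `d` use no other variables.
  have hdet : ∀ (M : Type) [Group M] [Countable M] (u : ℕ → M), P M →
      (∀ l ∈ R₁ ++ (R₂ ++ R₃), GroupLiteral.Holds u l) →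
      ∀ w, (wordValue (u ∘ d) w = 1 ↔ wordValue (N₀.enum ∘ d) w = 1) := by
    intro M _ _ u hM hu w
    rw [List.forall_mem_append, List.forall_mem_append, hR₁, hR₂, hR₃] at hu
    obtain ⟨hu₁, hu₂, hu₃⟩ := hu
    have := hS M (u ∘ d) hM hu₃
    obtain ⟨N, e, he⟩ := exists_enumeratedGroup (M := M) (u := u) (K := K)
      fun i hi j hj h => (hu₂ i hi j hj).1 h
    have hval : ∀ w' : List (ℕ × Bool), (∀ p ∈ w', p.1 < K) →
        (wordValue N.enum w' = 1 ↔ wordValue u w' = 1) := fun w' hw' => by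
      rw [← MulEquiv.wordValue_eq_one_iff e,
        wordValue_congr (v := e ∘ N.enum) (v' := u) fun p hp => he p.1 (hw' p hp)]
    have hNd : e ∘ (N.enum ∘ d) = u ∘ d := funext fun i => he _ (hKd i)
    rw [← hNd, MulEquiv.wordValue_eq_one_iff e]
    exact hiso N (hax'.of_mulEquiv e.symm hM)
      (fun w' hw' => (hval w' (hKW w' hw')).trans (hu₁ w' hw')) w
  have hself : ∀ l ∈ R₁ ++ (R₂ ++ R₃), GroupLiteral.Holds N₀.enum l := by
    rw [List.forall_mem_append, List.forall_mem_append, hR₁, hR₂, hR₃]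
    exact ⟨fun w _ => Iff.rfl, fun i _ j _ => Iff.rfl, hS₀⟩
  have hsat : ∀ (b : Bool) (w : List (Fin n × Bool)),
      SatisfiableIn T ((R₁ ++ (R₂ ++ R₃)) ++ [(renameWord d w, b)]) ↔
        (wordValue (N₀.enum ∘ d) w = 1 ↔ b = true) := by
    intro b w
    constructor
    · rintro ⟨M, _, _, u, hM, hu⟩
      rw [List.forall_mem_append, List.forall_mem_singleton, GroupLiteral.holds_iff,
        wordValue_renameWord] at hu
      rw [← hdet M u ((hT M).2 hM) hu.1]
      exact hu.2
    · intro h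
      refine ⟨N₀.Carrier, inferInstance, inferInstance, N₀.enum, (hT _).1 hN₀, ?_⟩
      rw [List.forall_mem_append, List.forall_mem_singleton, GroupLiteral.holds_iff,
        wordValue_renameWord]
      exact ⟨hself, h⟩
  have hcomp : ∀ b : Bool, Computable fun w : List (Fin n × Bool) =>
      (((R₁ ++ (R₂ ++ R₃)) ++ [(renameWord d w, b)] : GroupSystem)) := fun b => by
    have hren : Primrec fun w : List (Fin n × Bool) => renameWord d w :=
      Primrec.list_map Primrec.id
        (((Primrec.dom_finite d).comp (Primrec.fst.comp Primrec.snd)).pair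
          (Primrec.snd.comp Primrec.snd)).to₂
    exact (Primrec.list_append.comp (Primrec.const _)
      (Primrec.list_cons.comp (hren.pair (Primrec.const b)) (Primrec.const []))).to_comp
  -- Post's theorem: `w` is trivial iff adding `w ≠ e` is unsatisfiable, and nontrivial iff adding
  -- `w = e` is.
  refine ComputablePred.computable_iff_re_compl_re'.2 ⟨?_, ?_⟩
  · exact (rePred_not_satisfiableIn hTc (hcomp false)).of_eq fun w => by rw [hsat]; simp
  · exact (rePred_not_satisfiableIn hTc (hcomp true)).of_eq fun w => by rw [hsat]; simp

end Isolation

/-! ### The Baire category argument -/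

section Main

open Topology

/-- No isomorphism class is comeager. In a comeager class, Baire category isolates the relations of
some tuple solving the undecidable system by finitely many relations and non-relations; by
Herbrand's theorem the relations of that tuple are then decidable. Embeddability into simple
subgroups of finitely presented groups is not needed. -/
theorem isomorphismClass_notMem_residual {P : GroupProperty} (hundec : StronglyUndecidable P)
    (hax : RecursivelyAxiomatizable P) (hsub : ClosedUnderSubgroups P) (H : Type) [Group H] :
    isomorphismClass P H ∉ residual (EnumeratedGroupsWith P) := by
  intro hres
  have := polishSpace_enumeratedGroupsWith hax hsub
  obtain ⟨n, S, ⟨H₀, _, _, t₀, hPH₀, ht₀⟩, hS⟩ := hundec.exists_system hsub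
  have hclopen : ∀ (c : Fin n → ℕ) (w : List (Fin n × Bool)) (q : Prop),
      IsClopen {N : EnumeratedGroupsWith P | wordValue (N.val.enum ∘ c) w = 1 ↔ q} :=
    fun c w q => by
      simp only [← wordValue_renameWord]
      exact (isClopen_setOf_wordValue_iff (renameWord c w) q).preimage continuous_subtype_val
  have hinf : Infinite H₀ := (hS H₀ t₀ hPH₀ ht₀).1
  obtain ⟨N, e, -⟩ := exists_enumeratedGroup (M := H₀) (u := fun _ => 1) (K := 0)
    (fun i hi => absurd hi (Nat.not_lt_zero i))
  let c : Fin n → ℕ := fun i => N.index (e.symm (t₀ i))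
  have hec : e ∘ (N.enum ∘ c) = t₀ := funext fun i => e.apply_symm_apply (t₀ i)
  let N' : EnumeratedGroupsWith P := ⟨N, hax.of_mulEquiv e.symm hPH₀⟩
  have hopen : IsOpen {M : EnumeratedGroupsWith P | TupleSatisfies (M.val.enum ∘ c) S} := by
    have : {M : EnumeratedGroupsWith P | TupleSatisfies (M.val.enum ∘ c) S} = ⋂ l ∈ {l | l ∈ S},
        {M : EnumeratedGroupsWith P | wordValue (M.val.enum ∘ c) l.1 = 1 ↔ l.2 = true} := by
      ext M
      simp [TupleSatisfies, -Prod.forall]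
    rw [this]
    exact (List.finite_toSet S).isOpen_biInter fun l _ => (hclopen c l.1 _).isOpen
  have hN' : TupleSatisfies (N'.val.enum ∘ c) S := fun l hl => by
    rw [← MulEquiv.wordValue_eq_one_iff e]
    change wordValue (e ∘ (N.enum ∘ c)) l.1 = 1 ↔ _
    rw [hec]
    exact ht₀ l hl
  -- In a Polish space a comeager class is dense, so it meets the nonempty open set of groups where
  -- `c` solves `S`.
  obtain ⟨N₁, hN₁, ⟨e₁⟩⟩ := (dense_of_mem_residual hres).inter_open_nonempty _ hopen ⟨N', hN'⟩
  let C : (Fin n → ℕ) → Set (EnumeratedGroupsWith P) := fun d =>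
    {M | ∀ w, (wordValue (M.val.enum ∘ d) w = 1 ↔ wordValue (N₁.val.enum ∘ c) w = 1)}
  have hclosed : ∀ d, IsClosed (C d) := fun d => by
    have : C d = ⋂ w, {M : EnumeratedGroupsWith P |
        wordValue (M.val.enum ∘ d) w = 1 ↔ wordValue (N₁.val.enum ∘ c) w = 1} := by
      ext M
      simp [C]
    rw [this]
    exact isClosed_iInter fun w => (hclopen d w _).isClosed
  -- Otherwise some `M` in the class avoids every `C d`; but an isomorphism from `N₁` to `M` carries
  -- the tuple at `c` to one at some `d` with the same relations.
  obtain ⟨d, hd⟩ : ∃ d, (interior (C d)).Nonempty := by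
    by_contra! hempty
    have hcompl : ⋂ d, (C d)ᶜ ∈ residual (EnumeratedGroupsWith P) :=
      countable_iInter_mem.2 fun d => residual_of_dense_open (hclosed d).isOpen_compl
        (interior_eq_empty_iff_dense_compl.1 (hempty d))
    have : Nonempty (EnumeratedGroupsWith P) := ⟨N'⟩
    obtain ⟨M, ⟨e₂⟩, hM⟩ := (dense_of_mem_residual (Filter.inter_mem hres hcompl)).nonempty
    let e₃ : N₁.val.Carrier ≃* M.val.Carrier := e₁.trans e₂.symm
    refine Set.mem_iInter.1 hM (fun i => M.val.index (e₃ (N₁.val.enum (c i)))) fun w => ?_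
    exact MulEquiv.wordValue_eq_one_iff e₃ (N₁.val.enum ∘ c) w
  obtain ⟨N₀, hN₀⟩ := hd
  obtain ⟨U, hU, hUC⟩ := (mem_nhds_subtype _ _ _).1 (mem_interior_iff_mem_nhds.1 hN₀)
  obtain ⟨W, hW, hWU⟩ := exists_finite_words_of_mem_nhds hU
  have hN₀C : N₀ ∈ C d := interior_subset hN₀
  have hN₀S : TupleSatisfies (N₀.val.enum ∘ d) S := fun l hl => (hN₀C l.1).trans (hN₁ l hl)
  refine (hS N₀.val.Carrier (N₀.val.enum ∘ d) N₀.2 hN₀S).2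
    (computablePred_relations_of_isolated hax N₀.2 d hW (fun M hM hMW w => ?_) hN₀S
      fun H' _ _ t hH' ht => (hS H' t hH' ht).1)
  have hMC : (⟨M, hM⟩ : EnumeratedGroupsWith P) ∈ C d := hUC (hWU M hMW)
  exact (hMC w).trans (hN₀C w).symm

end Main

end EnumGrp

theorem theorem1p7 (P : EnumGrp.GroupProperty)
    (hundec : EnumGrp.StronglyUndecidable P)
    (hax : EnumGrp.RecursivelyAxiomatizable P)
    (hBH : EnumGrp.BooneHigman P)
    (hsub : EnumGrp.ClosedUnderSubgroups P) :
    PolishSpace (EnumGrp.EnumeratedGroupsWith P) ∧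
      ∀ (H : Type) [Group H],
        EnumGrp.isomorphismClass P H ∉ residual (EnumGrp.EnumeratedGroupsWith P) :=
  ⟨EnumGrp.polishSpace_enumeratedGroupsWith hax hsub,
    fun H _ => EnumGrp.isomorphismClass_notMem_residual hundec hax hsub H⟩
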